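/- Let $\mathcal A=[0,1)\times[0,1)$ with Lebesgue measure $\lambda$, let $\mathcal R_\alpha(x,y)=(x+\alpha \bmod 1,\,y)$, and for $a,b\ge 1$ put $R^{a,b}_{i,j}=[\frac ia,\frac{i+1}a)\times[\frac jb,\frac{j+1}b)$ ($0\le i<a$, $0\le j<b$). **Anosov–Katok data.** Let $(k_n),(l_n),(s_n)$ be sequences of positive integers with $s_0\ge 2$, $s_n\mid s_{n+1}$, $s_n\mid k_n$, $s_{n+1}\le s_n^{k_n}$. Put $p_0=0$, $q_0=1$, $p_{n+1}=p_nq_nk_nl_n+1$, $q_{n+1}=k_nl_nq_n^2$, $\alpha_n=p_n/q_n$. Let $(X,\mu)$ be a probability space with an isomorphism $Z:(\mathcal A,\lambda)\to(X,\mu)$. For $n\ge 0$ let $h_{n+1}$ be an invertible measure preserving transformation of $\mathcal A$ that commutes with $\mathcal R_{\alpha_n}$ and permutes the atoms of $\xi_{n+1}=\{R^{q_{n+1},s_{n+1}}_{i,j}\}$, the atoms of $\{R^{k_nq_n,s_{n+1}}_{i,j}\}$, and those of the latter atoms that lie inside $[0,1/q_n)\times[0,1)$. Put $Z_0=Z$,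 $Z_n=Z\circ h_1\circ\dots\circ h_n$, $T_n=Z_n\mathcal R_{\alpha_n}Z_n^{-1}$; let $\zeta_n=Z_n\xi_n$ (with $\xi_0=\{R^{1,s_0}_{0,j}\}$) and let $\tau_n$ be the permutation of $\zeta_n$ induced by $T_n$. An invertible measure preserving $T:X\to X$ is a *limit* of $(\tau_n)$ if $\lim_n\mu\big(\bigcup_{A\in\zeta_m}(T_nA\,\triangle\,TA)\big)=0$ for every $m$. For $r<s_{n+1}$ and $t<k_n$ let $j_t=j_t(n,r)$ be the index with $h_{n+1}(R^{k_nq_n,s_{n+1}}_{t,r})\subseteq R^{q_n,s_n}_{0,j_t}$. *Requirement 1:* $s_n\to\infty$. *Requirement 2:* for all $n$, $r<s_{n+1}$ and $j<s_n$ there are exactly $k_n/s_n$ numbers $t<k_n$ with $j_t(n,r)=j$. *Requirement 3:* for each $n$ the map $r\mapsto(j_0,\dots,j_{k_n-1})$ is one-to-one. **Construction sequence.** Let $\Sigma=\{a_i:i<s_0\}$ and let $b,e\notin\Sigma$ be two further letters. For words $w_0,\dots,w_{k_n-1}$ put $$\mathcal C_n(w_0,\dots,w_{k_n-1})=\prod_{i=0}^{q_n-1}\prod_{j=0}^{k_n-1}b^{\,q_n-d_i}\,w_j^{\,l_n-1}\,e^{\,d_i},\qquad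 d_i\equiv p_n^{-1}i \pmod{q_n},\ 0\le d_i<q_n .$$ Let $u^0_i=a_i$ for $i<s_0$, and $u^{n+1}_r=\mathcal C_n(u^n_{j_0},\dots,u^n_{j_{k_n-1}})$ with $j_t=j_t(n,r)$ for $r<s_{n+1}$; put $\mathcal W_n=\{u^n_r:r<s_n\}$. Let $\mathbb K\subseteq(\Sigma\cup\{b,e\})^{\mathbb Z}$ be the set of all sequences every finite contiguous subword of which occurs in some word of some $\mathcal W_n$, and let $sh$ be the shift. **The partition $\mathcal Q$.** At stage $n+1$ a point $x\in X$ gets the label $b$ (resp. $e$) if the first coordinate of $Z_{n+1}^{-1}x$ lies in an interval $[\frac{i}{q_{n+1}},\frac{i+1}{q_{n+1}})$ with $i\equiv t\,p_{n+1}\pmod{q_{n+1}}$, $0\le t<q_{n+1}$, where position $t$ of $\mathcal C_n(w_0,\dots,w_{k_n-1})$, with all $|w_j|=q_n$, belongs to one of the blocks $b^{q_n-d_i}$ (resp. $e^{d_i}$) displayed above. Let $B$ (resp. $E$) be the set of points that are labelled at least once, but only finitely often, and whose last label is $b$ (resp. $e$). Let $A_i=Z\big([0,1)\times[\frac i{s_0},\frac{i+1}{s_0})\big)\setminus(B\cup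 E)$ and $\mathcal Q=\{A_i:i<s_0\}\cup\{B,E\}$. The $\mathcal Q$-name of $x$ is the sequence in $(\Sigma\cup\{b,e\})^{\mathbb Z}$ whose $n$-th letter is $a_i$, $b$ or $e$ according to whether $T^nx$ is in $A_i$, $B$ or $E$. **Theorem.** Suppose that Requirements 1–3 hold, that $(l_n)$ grows fast enough that $\sum_n 1/l_n<\infty$, and that $T$ is a limit of $(\tau_n)$. Then for almost every $x\in X$ the $\mathcal Q$-name of $x$ belongs to $\mathbb K$. Moreover there is a shift-invariant Borel probability measure $\nu$ on $\mathbb K$ such that $(\mathbb K,\nu,sh)$ is isomorphic to the factor of $(X,\mu,T)$ generated by $\mathcal Q$: the map sending $x$ to its $\mathcal Q$-name is a factor map onto $(\mathbb K,\nu,sh)$ whose $\sigma$-algebra is, modulo null sets, the one generated by $\{T^nA:A\in\mathcal Q,\,n\in\mathbb Z\}$, and $(\mathbb K,\nu,sh)$ is isomorphic modulo null sets to every measure preserving system on a standard Borel space that is a factor of $(X,\mu,T)$ with this $\sigma$-algebra. -/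

import Mathlib

open MeasureTheory Filter Set
open scoped Topology

universe u v

namespace AK

noncomputable section

/-! ### The annulus, its rotations and its grids -/

/-- The space `[0,1) × [0,1)`. -/
abbrev Ann : Type := Ico (0 : ℝ) 1 × Ico (0 : ℝ) 1

/-- Lebesgue measure on `[0,1) × [0,1)`. -/
def leb : Measure Ann :=
  ((volume : Measure ℝ).comap Subtype.val).prod ((volume : Measure ℝ).comap Subtype.val)

/-- Rotation by `α` (addition of `α` modulo one) in the first coordinate. -/
def rot (α : ℝ) (x : Ann) : Ann :=
  (⟨Int.fract ((x.1 : ℝ) + α), Int.fract_nonneg _, Int.fract_lt_one _⟩, x.2)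

/-- `[i/a, (i+1)/a) × [j/b, (j+1)/b)`. -/
def rect (a b i j : ℕ) : Set Ann :=
  {x | (x.1 : ℝ) ∈ Ico ((i : ℝ) / a) (((i : ℝ) + 1) / a) ∧
    (x.2 : ℝ) ∈ Ico ((j : ℝ) / b) (((j : ℝ) + 1) / b)}

/-- The atoms of the partition of the annulus into `a` columns and `b` rows of equal size. -/
def grid (a b : ℕ) : Set (Set Ann) :=
  {A | ∃ i < a, ∃ j < b, A = rect a b i j}

/-! ### Numerical sequences -/

/-- `q 0 = 1`, `q (n+1) = k n * l n * (q n)^2`. -/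
def qSeq (k l : ℕ → ℕ) : ℕ → ℕ
  | 0 => 1
  | n + 1 => k n * l n * qSeq k l n ^ 2

/-- `p 0 = 0`, `p (n+1) = p n * q n * k n * l n + 1`. -/
def pSeq (k l : ℕ → ℕ) : ℕ → ℕ
  | 0 => 0
  | n + 1 => pSeq k l n * qSeq k l n * k n * l n + 1

/-! ### Words -/

/-- The alphabet `Σ ∪ {b, e}`, where `Σ = {a i : i ∈ ι}`. -/
inductive Letter (ι : Type) : Type
  | a (i : ι) : Letter ι
  | b : Letter ι
  | e : Letter ι

instance (ι : Type) : MeasurableSpace (Letter ι) := ⊤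

/-- `j_i`: the number in `{0, …, q-1}` congruent to `p⁻¹ i` modulo `q` (it is `0` when `q = 1`). -/
def jnum (p q i : ℕ) : ℕ := ((p : ZMod q)⁻¹ * (i : ZMod q)).val

/-- The circular operation
`C(w_0, …, w_{k-1}) = ∏_{i<q} ∏_{j<k} b^{q - j_i} w_j^{l-1} e^{j_i}`. -/
def circ {ι : Type} (k l p q : ℕ) (w : Fin k → List (Letter ι)) : List (Letter ι) :=
  (List.range q).flatMap fun i => (List.finRange k).flatMap fun j =>
    List.replicate (q - jnum p q i) Letter.b ++ (List.replicate (l - 1) (w j)).flatten ++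
      List.replicate (jnum p q i) Letter.e

/-! ### The abstract untwisted Anosov–Katok method -/

/-- The data of an (untwisted, abstract) Anosov–Katok construction on `(X, μ)`. The transformation
`h 0` plays no role. -/
structure Construction (X : Type u) [MeasurableSpace X] (μ : Measure X) where
  k : ℕ → ℕ
  l : ℕ → ℕ
  s : ℕ → ℕ
  k_pos : ∀ n, 0 < k n
  l_pos : ∀ n, 0 < l n
  s_pos : ∀ n, 0 < s n
  two_le_s_zero : 2 ≤ s 0
  s_dvd_s : ∀ n, s n ∣ s (n + 1)
  s_dvd_k : ∀ n, s n ∣ k n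
  s_le_pow : ∀ n, s (n + 1) ≤ s n ^ k n
  /-- the fixed isomorphism of the annulus with `X` -/
  Z : Ann ≃ᵐ X
  Z_measurePreserving : MeasurePreserving Z leb μ
  h : ℕ → Ann ≃ᵐ Ann
  h_measurePreserving : ∀ n, MeasurePreserving (h (n + 1)) leb leb
  /-- `h (n+1)` commutes with the rotation by `α n = p n / q n` -/
  h_comm : ∀ n x, h (n + 1) (rot ((pSeq k l n : ℝ) / qSeq k l n) x) =
    rot ((pSeq k l n : ℝ) / qSeq k l n) (h (n + 1) x)
  /-- `h (n+1)` permutes the atoms of `ξ (n+1)` -/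
  h_perm_fine : ∀ n, ∀ A ∈ grid (qSeq k l (n + 1)) (s (n + 1)),
    h (n + 1) '' A ∈ grid (qSeq k l (n + 1)) (s (n + 1))
  /-- `h (n+1)` permutes the atoms of the `k n * q n` by `s (n+1)` grid -/
  h_perm : ∀ n, ∀ A ∈ grid (k n * qSeq k l n) (s (n + 1)),
    h (n + 1) '' A ∈ grid (k n * qSeq k l n) (s (n + 1))
  /-- untwistedness: `h (n+1)` permutes those atoms of the latter grid which lie inside
  `[0, 1 / q n) × [0,1)` -/
  h_untwisted : ∀ n, ∀ t < k n, ∀ r < s (n + 1), ∃ t' < k n, ∃ r' < s (n + 1),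
    h (n + 1) '' rect (k n * qSeq k l n) (s (n + 1)) t r =
      rect (k n * qSeq k l n) (s (n + 1)) t' r'

namespace Construction

variable {X : Type u} [MeasurableSpace X] {μ : Measure X} (D : Construction X μ)

abbrev p (n : ℕ) : ℕ := pSeq D.k D.l n

abbrev q (n : ℕ) : ℕ := qSeq D.k D.l n

/-- `Z_n = Z ∘ h_1 ∘ ⋯ ∘ h_n`. -/
def Zn : ℕ → (Ann ≃ᵐ X)
  | 0 => D.Z
  | n + 1 => (D.h (n + 1)).trans (Zn n)

/-- `T_n = Z_n ∘ R_{α_n} ∘ Z_n⁻¹`, the pointwise realization of the `n`-th periodic process, which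
permutes the atoms of `ζ_n`. -/
def Tn (n : ℕ) (x : X) : X :=
  D.Zn n (rot ((D.p n : ℝ) / D.q n) ((D.Zn n).symm x))

/-- The atoms of the partition `ζ_n = Z_n ξ_n` of `X`. -/
def zeta (n : ℕ) : Set (Set X) :=
  {A | ∃ R ∈ grid (D.q n) (D.s n), A = D.Zn n '' R}

/-- `T` is the limit of the periodic processes: for every `m`, the measure of
`⋃_{A ∈ ζ_m} (τ_n A ∆ T A)` tends to `0` as `n → ∞`. -/
def IsLimit (T : X ≃ᵐ X) : Prop :=
  ∀ m, Tendsto (fun n => μ (⋃ A ∈ D.zeta m, symmDiff (D.Tn n '' A) (T '' A))) atTop (𝓝 0)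

/-- First requirement: `s_n → ∞`. -/
def Requirement1 : Prop := Tendsto D.s atTop atTop

/-- Second requirement (strong uniformity). -/
def Requirement2 : Prop :=
  ∀ n, ∀ j < D.s n, ∀ r < D.s (n + 1),
    Set.ncard {t : ℕ | t < D.k n ∧
      D.h (n + 1) '' rect (D.k n * D.q n) (D.s (n + 1)) t r ⊆ rect (D.q n) (D.s n) 0 j} =
    D.k n / D.s n

theorem qSeq_pos {k l : ℕ → ℕ} (hk : ∀ n, 0 < k n) (hl : ∀ n, 0 < l n) (n : ℕ) :
    0 < qSeq k l n := by
  induction n with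
  | zero => simp [qSeq]
  | succ n ih =>
    have := hk n
    have := hl n
    simp only [qSeq]
    positivity

theorem exists_tuple (n : ℕ) (r : Fin (D.s (n + 1))) (t : Fin (D.k n)) :
    ∃ j : Fin (D.s n), D.h (n + 1) '' rect (D.k n * D.q n) (D.s (n + 1)) t r ⊆
      rect (D.q n) (D.s n) 0 j := by
  obtain ⟨t', ht', r', hr', he⟩ := D.h_untwisted n t t.2 r r.2
  obtain ⟨c, hc⟩ := D.s_dvd_s n
  have hc0 : 0 < c := by
    rcases Nat.eq_zero_or_pos c with h0 | h0
    · have := D.s_pos (n + 1)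
      simp [hc, h0] at this
    · exact h0
  have hs := D.s_pos n
  have hq : 0 < D.q n := qSeq_pos D.k_pos D.l_pos n
  have hk := D.k_pos n
  have hdiv : r' / c < D.s n := by
    rw [Nat.div_lt_iff_lt_mul hc0, ← hc]
    exact hr'
  refine ⟨⟨r' / c, hdiv⟩, ?_⟩
  rw [he]
  rintro x ⟨⟨_, h2⟩, h3, h4⟩
  have hsR : (0 : ℝ) < D.s n := by exact_mod_cast hs
  have hcR : (0 : ℝ) < c := by exact_mod_cast hc0
  have hqR : (0 : ℝ) < D.q n := by exact_mod_cast hq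
  have hkR : (0 : ℝ) < D.k n := by exact_mod_cast hk
  have hcast : (D.s (n + 1) : ℝ) = D.s n * c := by rw [hc]; push_cast; ring
  rw [hcast] at h3 h4
  push_cast at h2
  rw [div_le_iff₀ (by positivity)] at h3
  rw [lt_div_iff₀ (by positivity)] at h4 h2
  have e1 : c * (r' / c) ≤ r' := Nat.mul_div_le r' c
  have e2 : r' + 1 ≤ c * (r' / c + 1) := Nat.lt_mul_div_succ r' hc0
  have e1R : (c : ℝ) * ((r' / c : ℕ) : ℝ) ≤ r' := by exact_mod_cast e1
  have e2R : (r' : ℝ) + 1 ≤ c * (((r' / c : ℕ) : ℝ) + 1) := by exact_mod_cast e2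
  have htR : (t' : ℝ) + 1 ≤ D.k n := by exact_mod_cast ht'
  refine ⟨⟨?_, ?_⟩, ?_, ?_⟩
  · simpa using x.1.2.1
  · rw [lt_div_iff₀ hqR]
    simp only [Nat.cast_zero, zero_add]
    nlinarith
  · rw [div_le_iff₀ hsR]
    simp only
    nlinarith
  · rw [lt_div_iff₀ hsR]
    simp only
    nlinarith

/-- The tuple `(j_0, …, j_{k_n - 1})_r`: the index `j_t` is the (unique) one with
`h_{n+1}([t/(k_n q_n), (t+1)/(k_n q_n)) × [r/s_{n+1}, (r+1)/s_{n+1})) ⊆ R^n_{0, j_t}`. -/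
def tuple (n : ℕ) (r : Fin (D.s (n + 1))) (t : Fin (D.k n)) : Fin (D.s n) :=
  (D.exists_tuple n r t).choose

/-- Third requirement: different rows have different tuples. -/
def Requirement3 : Prop := ∀ n, Function.Injective (D.tuple n)

/-! ### The construction sequence and its symbolic shift -/

/-- The word of the `r`-th tower of the `n`-th periodic process (the one with base
`Z_n R^n_{0,r}`). -/
def word : (n : ℕ) → Fin (D.s n) → List (Letter (Fin (D.s 0)))
  | 0, i => [Letter.a i]
  | n + 1, r => circ (D.k n) (D.l n) (D.p n) (D.q n) fun t => word n (D.tuple n r t)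

/-- The construction sequence `W_n`. -/
def W (n : ℕ) : Set (List (Letter (Fin (D.s 0)))) := Set.range (D.word n)

/-- The symbolic system `𝕂`: all bi-infinite sequences every finite contiguous subword of which
occurs inside some word of some `W_n`. -/
def K : Set (ℤ → Letter (Fin (D.s 0))) :=
  {f | ∀ (c : ℤ) (m : ℕ), ∃ n, ∃ w ∈ D.W n, (List.ofFn fun i : Fin m => f (c + i)) <:+: w}

/-- The shift on `𝕂`. -/
def shift (f : D.K) : D.K :=
  ⟨fun n => f.1 (n + 1), fun c m => by
    obtain ⟨n, w, hw, h⟩ := f.2 (c + 1) m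
    refine ⟨n, w, hw, ?_⟩
    have : (List.ofFn fun i : Fin m => f.1 (c + i + 1)) =
        List.ofFn fun i : Fin m => f.1 (c + 1 + i) := by
      congr 1; funext i; exact congrArg f.1 (by ring)
    rw [this]; exact h⟩

/-! ### The partition `Q` -/

/-- The word `C(w_0, …, w_{k_n - 1})` with all letters of the `w_j` (of length `q_n`) replaced by
one neutral letter, so that only the newly added `b`s and `e`s are seen. -/
def template (n : ℕ) : List (Letter Unit) :=
  circ (D.k n) (D.l n) (D.p n) (D.q n) fun _ => List.replicate (D.q n) (Letter.a ())

/-- The set of points of the annulus that receive the label `c` (`b` or `e`) at a given stage. At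
stage `n+1` the `t`-th letter of the template labels the whole column over the `t`-th interval
`[i/q_{n+1}, (i+1)/q_{n+1})`, `i ≡ t p_{n+1} mod q_{n+1}`, of the orbit of `[0, 1/q_{n+1})` under
rotation by `α_{n+1}`. There are no labels at stage `0`. -/
def marked (c : Letter Unit) : ℕ → Set Ann
  | 0 => ∅
  | n + 1 => {x | ∃ t : ℕ, (D.template n)[t]? = some c ∧
      (x.1 : ℝ) ∈ Ico (((t * D.p (n + 1) % D.q (n + 1) : ℕ) : ℝ) / D.q (n + 1))
        ((((t * D.p (n + 1) % D.q (n + 1) : ℕ) : ℝ) + 1) / D.q (n + 1))}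

/-- `Γ_n`: the points that receive no label `b` or `e` at any stage after `n`. -/
def Gam (n : ℕ) : Set X :=
  {x | ∀ m > n, (D.Zn m).symm x ∉ D.marked Letter.b m ∪ D.marked Letter.e m}

/-- The points whose last label is `b`. -/
def setB : Set X := {x | ∃ n, x ∈ D.Gam n ∧ (D.Zn n).symm x ∈ D.marked Letter.b n}

/-- The points whose last label is `e`. -/
def setE : Set X := {x | ∃ n, x ∈ D.Gam n ∧ (D.Zn n).symm x ∈ D.marked Letter.e n}

/-- The partition `Q = {A_i : i < s_0} ∪ {B, E}`, where `A_i` is the atom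
`Z([0,1) × [i/s_0, (i+1)/s_0))` of `ζ_0` without `B ∪ E`. -/
def Q : Letter (Fin (D.s 0)) → Set X
  | Letter.a i => D.Z '' rect 1 (D.s 0) 0 i \ (D.setB ∪ D.setE)
  | Letter.b => D.setB
  | Letter.e => D.setE

theorem jnum_le (p : ℕ) {q : ℕ} (hq : 0 < q) (i : ℕ) : jnum p q i ≤ q := by
  have : NeZero q := ⟨hq.ne'⟩
  exact (ZMod.val_lt _).le

theorem length_template (n : ℕ) : (D.template n).length = D.q (n + 1) := by
  have hq : 0 < D.q n := qSeq_pos D.k_pos D.l_pos n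
  have key : ∀ i : ℕ, D.q n - jnum (D.p n) (D.q n) i + (D.l n - 1) * D.q n +
      jnum (D.p n) (D.q n) i = D.l n * D.q n := by
    intro i
    have h1 := jnum_le (D.p n) hq i
    obtain ⟨m, hm⟩ := Nat.exists_eq_add_of_lt (D.l_pos n)
    rw [hm]
    simp only [zero_add, Nat.add_sub_cancel, add_mul, one_mul]
    omega
  simp only [template, circ, List.length_flatMap, List.length_append, List.length_replicate,
    List.length_flatten, List.map_replicate, List.sum_replicate, smul_eq_mul, key,
    List.map_const', List.length_range, List.length_finRange, q, qSeq]
  ring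

theorem coprime_pq (n : ℕ) : Nat.Coprime (D.p (n + 1)) (D.q (n + 1)) := by
  have h : ∀ m, m ∣ D.p n * D.q n * D.k n * D.l n → Nat.Coprime (D.p (n + 1)) m := by
    rintro m ⟨c, hc⟩
    have : D.p (n + 1) = 1 + c * m := by
      change D.p n * D.q n * D.k n * D.l n + 1 = _
      rw [hc]; ring
    rw [this]
    simp
  change Nat.Coprime _ (D.k n * D.l n * D.q n ^ 2)
  refine Nat.Coprime.mul_right (Nat.Coprime.mul_right ?_ ?_) (Nat.Coprime.pow_right 2 ?_)
  · exact h _ ⟨D.p n * D.q n * D.l n, by ring⟩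
  · exact h _ ⟨D.p n * D.q n * D.k n, by ring⟩
  · exact h _ ⟨D.p n * D.k n * D.l n, by ring⟩

theorem eq_of_mem_Ico {N : ℕ} (hN : 0 < N) {i j : ℕ} {x : ℝ}
    (hi : x ∈ Ico ((i : ℝ) / N) (((i : ℝ) + 1) / N))
    (hj : x ∈ Ico ((j : ℝ) / N) (((j : ℝ) + 1) / N)) : i = j := by
  have hNR : (0 : ℝ) < N := by exact_mod_cast hN
  obtain ⟨a1, a2⟩ := hi
  obtain ⟨b1, b2⟩ := hj
  rw [div_le_iff₀ hNR] at a1 b1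
  rw [lt_div_iff₀ hNR] at a2 b2
  have c1 : (i : ℝ) < j + 1 := by linarith
  have c2 : (j : ℝ) < i + 1 := by linarith
  have d1 : i < j + 1 := by exact_mod_cast c1
  have d2 : j < i + 1 := by exact_mod_cast c2
  omega

theorem marked_unique {c d : Letter Unit} {n : ℕ} {x : Ann}
    (hc : x ∈ D.marked c n) (hd : x ∈ D.marked d n) : c = d := by
  cases n with
  | zero => exact hc.elim
  | succ n =>
    obtain ⟨t, ht, hx⟩ := hc
    obtain ⟨t', ht', hx'⟩ := hd
    have hq : 0 < D.q (n + 1) := qSeq_pos D.k_pos D.l_pos (n + 1)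
    have e := eq_of_mem_Ico hq hx hx'
    have l1 : t < D.q (n + 1) := by
      rw [← D.length_template]; exact (List.getElem?_eq_some_iff.1 ht).1
    have l2 : t' < D.q (n + 1) := by
      rw [← D.length_template]; exact (List.getElem?_eq_some_iff.1 ht').1
    have e2 : t ≡ t' [MOD D.q (n + 1)] :=
      Nat.ModEq.cancel_right_of_coprime (D.coprime_pq n).symm e
    have e3 : t = t' := Nat.ModEq.eq_of_lt_of_lt e2 l1 l2
    subst e3
    rw [ht] at ht'
    exact Option.some.inj ht'

theorem disjoint_BE {x : X} (hb : x ∈ D.setB) (he : x ∈ D.setE) : False := by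
  obtain ⟨n, hn, hnb⟩ := hb
  obtain ⟨m, hm, hme⟩ := he
  rcases lt_trichotomy n m with h | h | h
  · exact hn m h (Or.inr hme)
  · subst h
    exact Letter.noConfusion rfl (heq_of_eq (D.marked_unique hnb hme))
  · exact hm n h (Or.inl hnb)

/-- `Q` is a partition of `X`. -/
theorem existsUnique_Q (x : X) : ∃! c, x ∈ D.Q c := by
  have hs := D.s_pos 0
  have hsR : (0 : ℝ) < D.s 0 := by exact_mod_cast hs
  by_cases hb : x ∈ D.setB
  · refine ⟨Letter.b, hb, ?_⟩
    rintro (i | _ | _) hc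
    · exact (hc.2 (Or.inl hb)).elim
    · rfl
    · exact (D.disjoint_BE hb hc).elim
  by_cases he : x ∈ D.setE
  · refine ⟨Letter.e, he, ?_⟩
    rintro (i | _ | _) hc
    · exact (hc.2 (Or.inr he)).elim
    · exact (hb hc).elim
    · rfl
  obtain ⟨y, rfl⟩ := D.Z.surjective x
  have hy0 : (0 : ℝ) ≤ y.2 := y.2.2.1
  have hy1 : (y.2 : ℝ) < 1 := y.2.2.2
  have hnn : (0 : ℝ) ≤ y.2 * D.s 0 := by positivity
  have hi : ⌊(y.2 : ℝ) * D.s 0⌋₊ < D.s 0 := by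
    rw [Nat.floor_lt hnn]
    nlinarith
  refine ⟨Letter.a ⟨_, hi⟩, ⟨⟨y, ⟨?_, ?_, ?_⟩, rfl⟩, ?_⟩, ?_⟩
  · simp
  · rw [div_le_iff₀ hsR]
    exact Nat.floor_le hnn
  · rw [lt_div_iff₀ hsR]
    exact Nat.lt_floor_add_one _
  · rintro (h | h)
    · exact hb h
    · exact he h
  · rintro (i | _ | _) hc
    · obtain ⟨⟨z, hz, hzy⟩, -⟩ := hc
      have : z = y := D.Z.injective hzy
      subst this
      congr 1
      apply Fin.ext
      refine eq_of_mem_Ico hs hz.2 ⟨?_, ?_⟩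
      · rw [div_le_iff₀ hsR]
        exact Nat.floor_le hnn
      · rw [lt_div_iff₀ hsR]
        exact Nat.lt_floor_add_one _
    · exact (hb hc).elim
    · exact (he hc).elim

/-- The letter of the atom of `Q` that contains `x`. -/
def letter (x : X) : Letter (Fin (D.s 0)) := (D.existsUnique_Q x).choose

/-- The `(T, Q)`-name of `x`. -/
def name (T : X ≃ᵐ X) (x : X) (n : ℤ) : Letter (Fin (D.s 0)) :=
  D.letter (((T.toEquiv : Equiv.Perm X) ^ n) x)

/-- The members of the smallest `σ`-algebra containing `T^n C` for all `C ∈ Q` and `n ∈ ℤ`. -/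
def factorAlgebra (T : X ≃ᵐ X) : Set (Set X) :=
  {A | MeasurableSet[MeasurableSpace.generateFrom
    {C | ∃ (n : ℤ) (c : Letter (Fin (D.s 0))), C = ((T.toEquiv : Equiv.Perm X) ^ n) '' D.Q c}] A}

end Construction

/-! ### Factors and isomorphisms of measure preserving systems -/

/-- `π : (X, μ, T) → (Y, κ, S)` is a factor map that exhibits `(Y, κ, S)` as the factor of
`(X, μ, T)` given by the `σ`-algebra `F`: the sets `π⁻¹ C` and the members of `F` are the same
modulo null sets. -/
structure IsFactorMapOnto {X : Type u} {Y : Type v} [MeasurableSpace X] [MeasurableSpace Y]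
    (μ : Measure X) (T : X → X) (F : Set (Set X)) (κ : Measure Y) (S : Y → Y)
    (π : X → Y) : Prop where
  measurePreserving : MeasurePreserving π μ κ
  equivariant : π ∘ T =ᵐ[μ] S ∘ π
  preimage_mem : ∀ C : Set Y, MeasurableSet C → ∃ A ∈ F, π ⁻¹' C =ᵐ[μ] A
  mem_preimage : ∀ A ∈ F, ∃ C : Set Y, MeasurableSet C ∧ A =ᵐ[μ] π ⁻¹' C

/-- Isomorphism, modulo null sets, of measure preserving systems. -/
def Isomorphic {Y : Type u} {Y' : Type v} [MeasurableSpace Y] [MeasurableSpace Y']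
    (κ : Measure Y) (S : Y → Y) (κ' : Measure Y') (S' : Y' → Y') : Prop :=
  ∃ (f : Y → Y') (g : Y' → Y), MeasurePreserving f κ κ' ∧ MeasurePreserving g κ' κ ∧
    g ∘ f =ᵐ[κ] id ∧ f ∘ g =ᵐ[κ'] id ∧ f ∘ S =ᵐ[κ] S' ∘ f

end

end AK

/-! Stage `n` cuts `X` into `s_n` towers of height `q_n`; the level `t` of tower `r` is the column
`t p_n mod q_n` in row `r`, seen through `Z_n`, and `T_n` moves each level to the next one. The
circular operator records how a tower of stage `n+1` runs through the towers of stage `n`: at a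
position in a block `w_j^{l-1}`, the point is on the corresponding level of the tower given by `j_t`
(`OnLevel.descend`). The choice `d_i ≡ p_n⁻¹ i` is what aligns the copies of `w_j` with the levels.
Hence a point with no label after stage `n` on level `t` of tower `r` has as its `Q`-letter the
`t`-th letter of the `r`-th word (`word_getElem?`).

Three sets spoil this along an orbit piece of fixed length `M`: points labelled after stage `n`,
points where `T` and `T_n` move the atoms of `ζ_n` differently, and points within `M` levels of the
top. A stage labels a proportion at most `1/l_n`, and consecutive `τ_n` disagree on measure at most
`1/l_n`, so summability makes the first two small (`measure_compl_Gam_le`, `measure_errorSet_le`);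
the third has measure at most `M/l_n` at stage `n+1`. Outside these sets the piece of name is a
subword of one word (`exists_infix_of_notMem_badSet`), so almost every name lies in `K`.

The measure `ν` is the distribution of names. The factor algebra is exactly the family of preimages
under the name map, and on standard Borel spaces a factor is determined up to isomorphism by its
algebra (`isomorphic_of_isFactorMapOnto`). -/

namespace AK

/-! ### Grid cells as integer indices, rotations and measure of columns -/

/-- The index of the cell `[i/N, (i+1)/N)` that contains `x`. -/
noncomputable def cell (N : ℕ) (x : ℝ) : ℤ := ⌊x * N⌋

theorem mem_Ico_iff_cell {N : ℕ} (hN : 0 < N) (i : ℕ) (x : ℝ) :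
    x ∈ Ico ((i : ℝ) / N) (((i : ℝ) + 1) / N) ↔ cell N x = i := by
  have : (0 : ℝ) < N := by exact_mod_cast hN
  rw [cell, Int.floor_eq_iff, mem_Ico, div_le_iff₀ this, lt_div_iff₀ this]
  simp

theorem mem_rect_iff {a b : ℕ} (ha : 0 < a) (hb : 0 < b) {i j : ℕ} {x : Ann} :
    x ∈ rect a b i j ↔ cell a x.1 = i ∧ cell b x.2 = j :=
  and_congr (mem_Ico_iff_cell ha _ _) (mem_Ico_iff_cell hb _ _)

theorem cell_nonneg (N : ℕ) (x : Ico (0 : ℝ) 1) : 0 ≤ cell N x :=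
  Int.floor_nonneg.2 (mul_nonneg x.2.1 N.cast_nonneg)

theorem cell_lt {N : ℕ} (hN : 0 < N) (x : Ico (0 : ℝ) 1) : cell N x < N := by
  have : (0 : ℝ) < N := by exact_mod_cast hN
  rw [cell, Int.floor_lt]
  have := x.2.2
  push_cast
  nlinarith

theorem exists_cell {N : ℕ} (hN : 0 < N) (x : Ico (0 : ℝ) 1) : ∃ i < N, cell N x = (i : ℕ) :=
  ⟨(cell N x).toNat, by have := cell_nonneg N x; have := cell_lt hN x; omega,
    by have := cell_nonneg N x; omega⟩

theorem cell_eq_div {N M : ℕ} (hM : 0 < M) (x : ℝ) : cell N x = cell (N * M) x / M := by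
  have hMR : (0 : ℝ) < M := by exact_mod_cast hM
  have hMZ : (0 : ℤ) < M := by exact_mod_cast hM
  rw [cell, cell, Int.floor_eq_iff]
  set z := ⌊x * ((N * M : ℕ) : ℝ)⌋ with hz
  have h1 : (z : ℝ) ≤ x * ((N * M : ℕ) : ℝ) := Int.floor_le _
  have h2 : x * ((N * M : ℕ) : ℝ) < z + 1 := Int.lt_floor_add_one _
  have e1 : z / M * M ≤ z := Int.ediv_mul_le _ hMZ.ne'
  have e2 : z + 1 ≤ (z / M + 1) * M := Int.lt_ediv_add_one_mul_self _ hMZ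
  have e1R : ((z / M : ℤ) : ℝ) * M ≤ z := by exact_mod_cast e1
  have e2R : (z : ℝ) + 1 ≤ ((z / M : ℤ) + 1) * M := by exact_mod_cast e2
  push_cast at h1 h2
  constructor
  · refine le_of_mul_le_mul_right ?_ hMR
    nlinarith
  · refine lt_of_mul_lt_mul_right ?_ hMR.le
    nlinarith

/-- A rotation by a multiple of `1/N` carries columns of width `1/N` to columns, so all dynamics on
the grid becomes arithmetic modulo `N`. -/
theorem cell_rot {N : ℕ} (hN : 0 < N) (c : ℤ) (x : Ann) :
    cell N (rot ((c : ℝ) / N) x).1 = (cell N x.1 + c) % N := by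
  have hNR : (0 : ℝ) < N := by exact_mod_cast hN
  have key : cell N (rot ((c : ℝ) / N) x).1 =
      cell N x.1 + c + N * (-⌊(x.1 : ℝ) + c / N⌋) := by
    have : ((rot ((c : ℝ) / N) x).1 : ℝ) * N =
        (x.1 : ℝ) * N + ((c + N * (-⌊(x.1 : ℝ) + c / N⌋) : ℤ) : ℝ) := by
      change Int.fract ((x.1 : ℝ) + c / N) * N = _
      rw [Int.fract]
      push_cast
      field_simp
      ring
    rw [cell, this, Int.floor_add_intCast, cell]
    ring
  have h := Int.emod_eq_of_lt (cell_nonneg N (rot ((c : ℝ) / N) x).1) (cell_lt hN _)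
  rw [key, Int.add_mul_emod_self_left] at h
  rw [key, h]

theorem rot_rot (α β : ℝ) (x : Ann) : rot α (rot β x) = rot (β + α) x := by
  refine Prod.ext (Subtype.ext ?_) rfl
  change Int.fract (Int.fract ((x.1 : ℝ) + β) + α) = Int.fract ((x.1 : ℝ) + (β + α))
  rw [Int.fract_eq_fract]
  exact ⟨-⌊(x.1 : ℝ) + β⌋, by rw [Int.fract]; push_cast; ring⟩

theorem rot_zero (x : Ann) : rot 0 x = x := by
  refine Prod.ext (Subtype.ext ?_) rfl
  change Int.fract ((x.1 : ℝ) + 0) = x.1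
  rw [add_zero, Int.fract_eq_self.2 ⟨x.1.2.1, x.1.2.2⟩]

theorem rot_neg_rot (α : ℝ) (x : Ann) : rot (-α) (rot α x) = x := by
  rw [rot_rot, add_neg_cancel, rot_zero]

theorem rot_rot_neg (α : ℝ) (x : Ann) : rot α (rot (-α) x) = x := by
  rw [rot_rot, neg_add_cancel, rot_zero]

theorem iterate_rot (α : ℝ) (n : ℕ) (x : Ann) : (rot α)^[n] x = rot (n * α) x := by
  induction n with
  | zero => simp [rot_zero]
  | succ n ih =>
    rw [Function.iterate_succ_apply', ih, rot_rot]
    push_cast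
    ring_nf

instance isProbabilityMeasure_comap_Ico :
    IsProbabilityMeasure ((volume : Measure ℝ).comap (Subtype.val : Ico (0 : ℝ) 1 → ℝ)) :=
  ⟨by rw [comap_subtype_coe_apply measurableSet_Ico, image_univ, Subtype.range_coe,
    Real.volume_Ico]; simp⟩

instance isProbabilityMeasure_leb : IsProbabilityMeasure leb := by
  unfold leb; infer_instance

theorem measurable_cell (N : ℕ) : Measurable (cell N) :=
  Int.measurable_floor.comp (measurable_id.mul_const _)

theorem leb_cell_eq_le {N : ℕ} (hN : 0 < N) (a : ℤ) :
    leb {x | cell N x.1 = a} ≤ (N : ENNReal)⁻¹ := by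
  have hNR : (0 : ℝ) < N := by exact_mod_cast hN
  have : {x : Ann | cell N x.1 = a} = {x : Ico (0 : ℝ) 1 | cell N x = a} ×ˢ univ := by
    ext x; simp
  rw [this, leb, Measure.prod_prod, measure_univ, mul_one,
    comap_subtype_coe_apply measurableSet_Ico]
  calc volume (Subtype.val '' {x : Ico (0 : ℝ) 1 | cell N x = a})
      ≤ volume (Ico ((a : ℝ) / N) ((a + 1) / N)) := by
        refine measure_mono ?_
        rintro _ ⟨x, hx, rfl⟩
        change ⌊(x : ℝ) * N⌋ = a at hx
        rw [Int.floor_eq_iff] at hx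
        rwa [mem_Ico, div_le_iff₀ hNR, lt_div_iff₀ hNR]
    _ = (N : ENNReal)⁻¹ := by
        rw [Real.volume_Ico, ← ENNReal.ofReal_natCast, ← ENNReal.ofReal_inv_of_pos hNR]
        congr 1
        field_simp
        ring

theorem leb_cell_mem_le {N : ℕ} (hN : 0 < N) {ι : Type*} (J : Finset ι) (f : ι → ℤ) :
    leb {x | ∃ i ∈ J, cell N x.1 = f i} ≤ J.card * (N : ENNReal)⁻¹ := by
  have : {x : Ann | ∃ i ∈ J, cell N x.1 = f i} = ⋃ i ∈ J, {x | cell N x.1 = f i} := by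
    ext x; simp
  rw [this]
  refine (measure_biUnion_finset_le _ _).trans ?_
  refine (Finset.sum_le_sum fun i _ => leb_cell_eq_le hN (f i)).trans ?_
  simp

/-! ### Words -/

theorem getElem?_flatMap_of_length {α β : Type*} (f : α → List β) (m : ℕ) (L : List α)
    (hf : ∀ x ∈ L, (f x).length = m) (i o : ℕ) (ho : o < m) :
    (L.flatMap f)[i * m + o]? = L[i]?.bind fun x => (f x)[o]? := by
  induction L generalizing i with
  | nil => simp
  | cons x L ih =>
    have hx : (f x).length = m := hf x (by simp)
    rw [List.flatMap_cons]
    cases i with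
    | zero =>
      rw [List.getElem?_append_left (by omega)]
      simp
    | succ i =>
      have : (i + 1) * m = i * m + m := by ring
      rw [List.getElem?_append_right (by omega), List.getElem?_cons_succ,
        ← ih (fun y hy => hf y (by simp [hy]))]
      congr 1
      omega

/-- The block `b^{q - d} w^{l-1} e^d` of a circular word. -/
def block {ι : Type} (l q d : ℕ) (w : List (Letter ι)) : List (Letter ι) :=
  List.replicate (q - d) Letter.b ++ (List.replicate (l - 1) w).flatten ++
    List.replicate d Letter.e

theorem length_block {ι : Type} {l q d : ℕ} (hl : 0 < l) (hd : d ≤ q) {w : List (Letter ι)}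
    (hw : w.length = q) : (block l q d w).length = l * q := by
  obtain ⟨l, rfl⟩ := Nat.exists_eq_add_of_lt hl
  simp only [block, List.length_append, List.length_replicate, List.length_flatten,
    List.map_replicate, List.sum_replicate, smul_eq_mul, hw, zero_add, Nat.add_sub_cancel, add_mul,
    one_mul]
  omega

theorem block_getElem?_b {ι : Type} {l q d o : ℕ} (w : List (Letter ι)) (ho : o < q - d) :
    (block l q d w)[o]? = some Letter.b := by
  rw [block, List.append_assoc, List.getElem?_append_left (by simpa using ho)]
  simp [ho]

theorem block_getElem?_mid {ι : Type} {l q d m v : ℕ} {w : List (Letter ι)} (hw : w.length = q)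
    (hm : m < l - 1) (hv : v < q) :
    (block l q d w)[q - d + (m * q + v)]? = w[v]? := by
  have hlen : (List.replicate (l - 1) w).flatten.length = (l - 1) * q := by
    simp [hw]
  have : m * q + v < (l - 1) * q := by
    have : (m + 1) * q ≤ (l - 1) * q := Nat.mul_le_mul_right _ hm
    rw [add_mul] at this
    omega
  rw [block, List.append_assoc, List.getElem?_append_right (by simp), List.length_replicate,
    Nat.add_sub_cancel_left, List.getElem?_append_left (by omega)]
  have := getElem?_flatMap_of_length id q (List.replicate (l - 1) w)
    (fun x hx => by rw [List.eq_of_mem_replicate hx]; exact hw) m v hv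
  rw [List.flatMap_id] at this
  rw [this, List.getElem?_replicate_of_lt hm]
  rfl

theorem block_getElem?_e {ι : Type} {l q d o : ℕ} {w : List (Letter ι)} (hw : w.length = q)
    (ho : o < d) :
    (block l q d w)[q - d + ((l - 1) * q + o)]? = some Letter.e := by
  have hlen : (List.replicate (l - 1) w).flatten.length = (l - 1) * q := by
    simp [hw]
  rw [block, List.getElem?_append_right (by simp [hw]), List.length_append,
    List.length_replicate, hlen]
  rw [show q - d + ((l - 1) * q + o) - (q - d + (l - 1) * q) = o by omega]
  simp [ho]

theorem length_flatMap_of_length {α β : Type*} (f : α → List β) (m : ℕ) (L : List α)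
    (hf : ∀ x ∈ L, (f x).length = m) : (L.flatMap f).length = L.length * m := by
  induction L with
  | nil => simp
  | cons x L ih =>
    rw [List.flatMap_cons, List.length_append, hf x (by simp), ih fun y hy => hf y (by simp [hy]),
      List.length_cons]
    ring

section circ

variable {ι : Type} {k l p q : ℕ} {w : Fin k → List (Letter ι)}

theorem length_circ (hl : 0 < l) (hq : 0 < q) (hw : ∀ j, (w j).length = q) :
    (circ k l p q w).length = q * (k * (l * q)) := by
  rw [circ, length_flatMap_of_length _ (k * (l * q)), List.length_range]
  intro i _
  rw [length_flatMap_of_length _ (l * q), List.length_finRange]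
  intro j _
  exact length_block hl (Construction.jnum_le p hq i) (hw j)

theorem circ_getElem? (hl : 0 < l) (hq : 0 < q) (hw : ∀ j, (w j).length = q) {i o : ℕ}
    (j : Fin k) (hi : i < q) (ho : o < l * q) :
    (circ k l p q w)[i * (k * (l * q)) + (j * (l * q) + o)]? =
      (block l q (jnum p q i) (w j))[o]? := by
  have hb : ∀ i j, (block l q (jnum p q i) (w j)).length = l * q := fun i j =>
    length_block hl (Construction.jnum_le p hq i) (hw j)
  have hj : j * (l * q) + o < k * (l * q) := by
    have : (j + 1) * (l * q) ≤ k * (l * q) := Nat.mul_le_mul_right _ j.2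
    rw [add_mul] at this
    omega
  have hlen : ∀ i, ((List.finRange k).flatMap fun j => block l q (jnum p q i) (w j)).length =
      k * (l * q) := fun i => by
    rw [length_flatMap_of_length _ (l * q) _ fun j _ => hb i j, List.length_finRange]
  have h1 := getElem?_flatMap_of_length
    (fun i => (List.finRange k).flatMap fun j => block l q (jnum p q i) (w j)) _ (List.range q)
    (fun i _ => hlen i) i _ hj
  have h2 := getElem?_flatMap_of_length (fun j => block l q (jnum p q i) (w j)) _
    (List.finRange k) (fun j _ => hb i j) j _ ho
  rw [List.getElem?_range hi, Option.bind_some, h2] at h1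
  refine h1.trans ?_
  simp

end circ

/-! ### Towers, and the words that describe them -/

namespace Construction

variable {X : Type u} [MeasurableSpace X] {μ : Measure X} (D : Construction X μ)

theorem q_pos (n : ℕ) : 0 < D.q n := qSeq_pos D.k_pos D.l_pos n

theorem q_succ (n : ℕ) : D.q (n + 1) = D.k n * D.q n * (D.l n * D.q n) := by
  change D.k n * D.l n * D.q n ^ 2 = _
  ring

theorem p_succ (n : ℕ) : D.p (n + 1) = D.p n * (D.k n * (D.l n * D.q n)) + 1 := by
  change D.p n * D.q n * D.k n * D.l n + 1 = _
  ring

theorem coprime_p_q : ∀ n, Nat.Coprime (D.p n) (D.q n)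
  | 0 => Nat.coprime_one_right _
  | n + 1 => D.coprime_pq n

theorem jnum_mul_modEq (n i : ℕ) :
    (jnum (D.p n) (D.q n) i : ℤ) * D.p n ≡ i [ZMOD D.q n] := by
  have : NeZero (D.q n) := ⟨(D.q_pos n).ne'⟩
  rw [← ZMod.intCast_eq_intCast_iff]
  push_cast
  rw [jnum, ZMod.natCast_zmod_val, mul_right_comm, mul_comm (_⁻¹),
    ZMod.coe_mul_inv_eq_one _ (D.coprime_p_q n), one_mul]

/-- The point `x` lies on the `t`-th level of the `r`-th tower of the `n`-th periodic process. -/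
def OnLevel (n r t : ℕ) (x : X) : Prop :=
  cell (D.q n) ((D.Zn n).symm x).1 = (t : ℤ) * D.p n % D.q n ∧
    cell (D.s n) ((D.Zn n).symm x).2 = r

theorem exists_onLevel (n : ℕ) (x : X) : ∃ r < D.s n, ∃ t < D.q n, D.OnLevel n r t x := by
  have : NeZero (D.q n) := ⟨(D.q_pos n).ne'⟩
  obtain ⟨r, hr, hr'⟩ := exists_cell (D.s_pos n) ((D.Zn n).symm x).2
  obtain ⟨i, hi, hi'⟩ := exists_cell (D.q_pos n) ((D.Zn n).symm x).1
  refine ⟨r, hr, jnum (D.p n) (D.q n) i, ZMod.val_lt _, ?_, hr'⟩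
  rw [hi', D.jnum_mul_modEq n i]
  exact (Int.emod_eq_of_lt (by omega) (by omega)).symm

theorem iterate_rot_h (n v : ℕ) (y : Ann) :
    D.h (n + 1) ((rot ((D.p n : ℝ) / D.q n))^[v] y) =
      (rot ((D.p n : ℝ) / D.q n))^[v] (D.h (n + 1) y) := by
  induction v with
  | zero => rfl
  | succ v ih =>
    rw [Function.iterate_succ_apply', Function.iterate_succ_apply', D.h_comm, ih]

theorem Zn_symm_eq (n : ℕ) (x : X) :
    (D.Zn n).symm x = D.h (n + 1) ((D.Zn (n + 1)).symm x) := by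
  change _ = D.h (n + 1) ((D.h (n + 1)).symm ((D.Zn n).symm x))
  rw [MeasurableEquiv.apply_symm_apply]

/-- A point in one of the blocks `w_j^{l-1}` of the stage `n+1` word passes through the levels of
the `j`-th of the stage `n` towers prescribed by the tuple. -/
theorem OnLevel.descend {n i m v : ℕ} {r : Fin (D.s (n + 1))} {j : Fin (D.k n)} {x : X}
    (hm : m < D.l n - 1) (hv : v < D.q n)
    (hx : D.OnLevel (n + 1) r (i * (D.k n * (D.l n * D.q n)) + (j * (D.l n * D.q n) +
      (D.q n - jnum (D.p n) (D.q n) i + (m * D.q n + v)))) x) :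
    D.OnLevel n (D.tuple n r j) v x := by
  set d := jnum (D.p n) (D.q n) i with hd
  have hdq : d ≤ D.q n := jnum_le _ (D.q_pos n) i
  -- This is the property defining `d`; `M` is the carry in `d p_n ≡ i` modulo `q_n`.
  obtain ⟨M, hM⟩ : ∃ M : ℤ, (d : ℤ) * D.p n = i + D.q n * M := by
    obtain ⟨M, hM⟩ := (D.jnum_mul_modEq n i).symm.dvd
    exact ⟨M, by rw [← hM]; ring⟩
  have hq := D.q_pos n
  have hk := D.k_pos n
  have hl := D.l_pos n
  have hlq : 0 < D.l n * D.q n := Nat.mul_pos hl hq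
  have hkq : 0 < D.k n * D.q n := Nat.mul_pos hk hq
  have hqR : (D.q n : ℝ) ≠ 0 := by exact_mod_cast hq.ne'
  have hkR : (D.k n : ℝ) ≠ 0 := by exact_mod_cast hk.ne'
  have hlR : (D.l n : ℝ) ≠ 0 := by exact_mod_cast hl.ne'
  obtain ⟨hx1, hx2⟩ := hx
  set y := (D.Zn (n + 1)).symm x with hy
  -- Rotation by `-v α_n`, in units of `1/q_{n+1}`: it brings `y` back to the cell that `h_{n+1}`
  -- sends to the base of a tower of stage `n`.
  set c : ℤ := -(v * D.p n * (D.k n * (D.l n * D.q n))) with hc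
  set y0 := rot ((c : ℝ) / D.q (n + 1)) y with hy0
  have ho : D.q n - d + (m * D.q n + v) < D.l n * D.q n := by
    have h1 : (m + 1 + 1) * D.q n ≤ D.l n * D.q n := Nat.mul_le_mul_right _ (by omega)
    rw [add_mul, add_mul] at h1
    omega
  have hjo : j * (D.l n * D.q n) + (D.q n - d + (m * D.q n + v)) < D.q (n + 1) := by
    rw [q_succ]
    have h1 : (j + 1) * (D.l n * D.q n) ≤ D.k n * D.q n * (D.l n * D.q n) :=
      Nat.mul_le_mul_right _ (le_trans j.2 (Nat.le_mul_of_pos_right _ hq))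
    rw [add_mul] at h1
    omega
  have h1 : cell (D.q (n + 1)) y0.1 =
      (j * (D.l n * D.q n) + (D.q n - d + (m * D.q n + v)) : ℕ) := by
    rw [hy0, cell_rot (D.q_pos _), hx1, Int.emod_add_emod]
    rw [← Int.emod_eq_of_lt (Int.natCast_nonneg _) (by exact_mod_cast hjo :
      ((j * (D.l n * D.q n) + (D.q n - d + (m * D.q n + v)) : ℕ) : ℤ) < D.q (n + 1))]
    refine Int.ModEq.symm ?_
    -- As `p_{n+1} = p_n k_n l_n q_n + 1`, the contribution `-d p_n k_n l_n q_n` of the offset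
    -- cancels `i k_n l_n q_n` modulo `q_{n+1}`. The quotient collects the remaining multiples, with
    -- the carry `M`.
    refine Int.modEq_iff_dvd.2 ⟨D.p n * (i * D.k n * D.l n + j * D.l n + 1 + m) - M, ?_⟩
    rw [q_succ, p_succ]
    push_cast [Nat.cast_sub hdq]
    rw [hc]
    linear_combination (-(D.k n * (D.l n * D.q n)) : ℤ) * hM
  have h2 : y0 ∈ rect (D.k n * D.q n) (D.s (n + 1)) j r := by
    rw [mem_rect_iff hkq (D.s_pos _)]
    refine ⟨?_, hx2⟩
    rw [cell_eq_div hlq, ← q_succ, h1]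
    norm_cast
    rw [mul_comm, Nat.mul_add_div hlq, Nat.div_eq_of_lt ho, add_zero]
  have h3 := (D.exists_tuple n r j).choose_spec (mem_image_of_mem _ h2)
  rw [mem_rect_iff hq (D.s_pos n)] at h3
  have h4 : y = (rot ((D.p n : ℝ) / D.q n))^[v] y0 := by
    rw [iterate_rot, hy0, rot_rot, hc, q_succ]
    convert (rot_zero y).symm using 2
    push_cast
    field_simp
    ring
  -- Since `h_{n+1}` commutes with `R_{α_n}`, the `v` rotation steps can be performed after it,
  -- which raises the base to level `v`.
  have h5 : (D.Zn n).symm x = rot (((v * D.p n : ℤ) : ℝ) / D.q n) (D.h (n + 1) y0) := by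
    rw [Zn_symm_eq, ← hy, h4, iterate_rot_h, iterate_rot]
    congr 1
    push_cast
    ring
  refine ⟨?_, ?_⟩
  · rw [h5, cell_rot hq, h3.1]
    simp
  · rw [h5]
    exact h3.2

theorem length_word : ∀ (n : ℕ) (r : Fin (D.s n)), (D.word n r).length = D.q n
  | 0, _ => rfl
  | n + 1, r => by
    rw [word, length_circ (D.l_pos n) (D.q_pos n) fun t => length_word n _, q_succ]
    ring

theorem exists_position {n t : ℕ} (ht : t < D.q (n + 1)) :
    ∃ i < D.q n, ∃ j : Fin (D.k n), ∃ o < D.l n * D.q n,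
      t = i * (D.k n * (D.l n * D.q n)) + (j * (D.l n * D.q n) + o) := by
  have hlq : 0 < D.l n * D.q n := Nat.mul_pos (D.l_pos n) (D.q_pos n)
  have hklq : 0 < D.k n * (D.l n * D.q n) := Nat.mul_pos (D.k_pos n) hlq
  refine ⟨t / (D.k n * (D.l n * D.q n)), ?_,
    ⟨t % (D.k n * (D.l n * D.q n)) / (D.l n * D.q n), ?_⟩,
    t % (D.k n * (D.l n * D.q n)) % (D.l n * D.q n), Nat.mod_lt _ hlq, ?_⟩
  · rw [Nat.div_lt_iff_lt_mul hklq]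
    rw [q_succ] at ht
    linarith
  · rw [Nat.div_lt_iff_lt_mul hlq]
    exact Nat.mod_lt _ hklq
  · simp only
    rw [Nat.div_add_mod', Nat.div_add_mod']

theorem position_cases {n i o : ℕ} (ho : o < D.l n * D.q n) :
    o < D.q n - jnum (D.p n) (D.q n) i ∨
    (∃ m < D.l n - 1, ∃ v < D.q n,
      o = D.q n - jnum (D.p n) (D.q n) i + (m * D.q n + v)) ∨
    ∃ o' < jnum (D.p n) (D.q n) i,
      o = D.q n - jnum (D.p n) (D.q n) i + ((D.l n - 1) * D.q n + o') := by
  have hd : jnum (D.p n) (D.q n) i ≤ D.q n := jnum_le _ (D.q_pos n) i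
  set d := jnum (D.p n) (D.q n) i
  rcases lt_or_ge o (D.q n - d) with h | h
  · exact Or.inl h
  obtain ⟨u, rfl⟩ := Nat.exists_eq_add_of_le h
  right
  rcases lt_or_ge u ((D.l n - 1) * D.q n) with h' | h'
  · refine Or.inl ⟨u / D.q n, ?_, u % D.q n, Nat.mod_lt _ (D.q_pos n), ?_⟩
    · rwa [Nat.div_lt_iff_lt_mul (D.q_pos n)]
    · rw [Nat.div_add_mod']
  · obtain ⟨o', rfl⟩ := Nat.exists_eq_add_of_le h'
    refine Or.inr ⟨o', ?_, rfl⟩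
    have := D.l_pos n
    have h1 : (D.l n - 1 + 1) * D.q n = D.l n * D.q n := by rw [Nat.sub_add_cancel this]
    rw [add_mul] at h1
    omega

theorem template_getElem? {n i o : ℕ} (j : Fin (D.k n)) (hi : i < D.q n)
    (ho : o < D.l n * D.q n) :
    (D.template n)[i * (D.k n * (D.l n * D.q n)) + (j * (D.l n * D.q n) + o)]? =
      (block (D.l n) (D.q n) (jnum (D.p n) (D.q n) i)
        (List.replicate (D.q n) (Letter.a ())))[o]? :=
  circ_getElem? (D.l_pos n) (D.q_pos n) (fun _ => List.length_replicate) j hi ho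

theorem word_succ_getElem? {n i o : ℕ} (r : Fin (D.s (n + 1))) (j : Fin (D.k n))
    (hi : i < D.q n) (ho : o < D.l n * D.q n) :
    (D.word (n + 1) r)[i * (D.k n * (D.l n * D.q n)) + (j * (D.l n * D.q n) + o)]? =
      (block (D.l n) (D.q n) (jnum (D.p n) (D.q n) i) (D.word n (D.tuple n r j)))[o]? :=
  circ_getElem? (D.l_pos n) (D.q_pos n) (fun _ => D.length_word n _) j hi ho

theorem OnLevel.mem_marked {n r t : ℕ} {x : X} {c : Letter Unit}
    (hx : D.OnLevel (n + 1) r t x) (hc : (D.template n)[t]? = some c) :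
    (D.Zn (n + 1)).symm x ∈ D.marked c (n + 1) :=
  ⟨t, hc, (mem_Ico_iff_cell (D.q_pos _) _ _).2 (by rw [hx.1]; push_cast; rfl)⟩

theorem mem_Gam_of_succ {n : ℕ} {x : X} (hx : x ∈ D.Gam (n + 1))
    (h : (D.Zn (n + 1)).symm x ∉ D.marked Letter.b (n + 1) ∪ D.marked Letter.e (n + 1)) :
    x ∈ D.Gam n := fun m hm => by
  rcases Nat.lt_or_eq_of_le (Nat.succ_le_of_lt hm) with h' | rfl
  · exact hx m h'
  · exact h

theorem letter_eq {x : X} {c : Letter (Fin (D.s 0))} (h : x ∈ D.Q c) : D.letter x = c :=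
  (D.existsUnique_Q x).unique (D.existsUnique_Q x).choose_spec.1 h

/-- Induction on the stage. A position in a block of `b` or `e` means that stage `n+1` gives the
last label, which is then the letter. Any other position carries no label at that stage, so the
point descends to stage `n`. At stage `0` no label is left and the row decides. -/
theorem word_getElem? : ∀ {n : ℕ} {r : Fin (D.s n)} {t : ℕ} {x : X}, t < D.q n →
    x ∈ D.Gam n → D.OnLevel n r t x → (D.word n r)[t]? = some (D.letter x)
  | 0, r, t, x, ht, hG, hx => by
    obtain rfl : t = 0 := by
      have : t < 1 := ht
      omega
    have hno : ∀ n c, (D.Zn n).symm x ∈ D.marked c n →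
        c = Letter.b ∨ c = Letter.e → False := by
      intro n c hc h
      rcases Nat.eq_zero_or_pos n with rfl | hn
      · exact hc
      · rcases h with rfl | rfl
        · exact hG n hn (Or.inl hc)
        · exact hG n hn (Or.inr hc)
    have : x ∈ D.Q (Letter.a r) := by
      refine ⟨⟨D.Z.symm x, ?_, D.Z.apply_symm_apply x⟩, ?_⟩
      · rw [mem_rect_iff one_pos (D.s_pos 0)]
        refine ⟨?_, hx.2⟩
        refine hx.1.trans ?_
        simp
      · rintro (⟨n, -, h2⟩ | ⟨n, -, h2⟩)
        · exact hno n _ h2 (Or.inl rfl)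
        · exact hno n _ h2 (Or.inr rfl)
    rw [D.letter_eq this]
    rfl
  | n + 1, r, t, x, ht, hG, hx => by
    obtain ⟨i, hi, j, o, ho, rfl⟩ := D.exists_position ht
    have hT := D.template_getElem? j hi ho
    rw [D.word_succ_getElem? r j hi ho]
    rcases D.position_cases (i := i) ho with h | ⟨m, hm, v, hv, rfl⟩ | ⟨o', ho', rfl⟩
    · rw [block_getElem?_b _ h] at hT ⊢
      rw [D.letter_eq (c := Letter.b) ⟨n + 1, hG, hx.mem_marked D hT⟩]
    · rw [block_getElem?_mid List.length_replicate hm hv, List.getElem?_replicate_of_lt hv] at hT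
      rw [block_getElem?_mid (D.length_word n _) hm hv]
      refine word_getElem? hv (D.mem_Gam_of_succ hG ?_) (hx.descend D hm hv)
      have h0 := hx.mem_marked D hT
      rintro (h | h)
      · exact Letter.noConfusion rfl (heq_of_eq (D.marked_unique h0 h))
      · exact Letter.noConfusion rfl (heq_of_eq (D.marked_unique h0 h))
    · rw [block_getElem?_e List.length_replicate ho'] at hT
      rw [block_getElem?_e (D.length_word n _) ho']
      rw [D.letter_eq (c := Letter.e) ⟨n + 1, hG, hx.mem_marked D hT⟩]

end Construction

/-! ### Measure of the labelled points -/

theorem natCast_mul_inv_le {c l N : ℕ} (hl : 0 < l) (hN : 0 < N) (h : c * l ≤ N) :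
    (c : ENNReal) * (N : ENNReal)⁻¹ ≤ (l : ENNReal)⁻¹ := by
  have hl' : (l : ENNReal) ≠ 0 := by exact_mod_cast hl.ne'
  have hN' : (N : ENNReal) ≠ 0 := by exact_mod_cast hN.ne'
  rw [← div_eq_mul_inv, ENNReal.div_le_iff hN' (ENNReal.natCast_ne_top N), mul_comm,
    ← div_eq_mul_inv, ENNReal.le_div_iff_mul_le (Or.inl hl') (Or.inl (ENNReal.natCast_ne_top l))]
  exact_mod_cast h

theorem measurableEmbedding_iterate {X : Type*} [MeasurableSpace X] (T : X ≃ᵐ X) (i : ℕ) :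
    MeasurableEmbedding (T^[i]) := by
  induction i with
  | zero => exact MeasurableEmbedding.id
  | succ i ih => exact ih.comp T.measurableEmbedding

namespace Construction

variable {X : Type u} [MeasurableSpace X] {μ : Measure X} (D : Construction X μ)

theorem Zn_measurePreserving : ∀ n, MeasurePreserving (D.Zn n) leb μ
  | 0 => D.Z_measurePreserving
  | n + 1 => (Zn_measurePreserving n).comp (D.h_measurePreserving n)

theorem measure_cell_mem_le (n : ℕ) {ι : Type*} (J : Finset ι) (f : ι → ℤ) :
    μ {x | ∃ i ∈ J, cell (D.q n) ((D.Zn n).symm x).1 = f i} ≤ J.card * (D.q n : ENNReal)⁻¹ := by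
  have := (D.Zn_measurePreserving n).symm.measure_preimage_equiv
    {y | ∃ i ∈ J, cell (D.q n) y.1 = f i}
  exact this.trans_le (leb_cell_mem_le (D.q_pos n) J f)

/-- The points that receive a label at stage `n`. -/
def labelled (n : ℕ) : Set X :=
  {x | (D.Zn n).symm x ∈ D.marked Letter.b n ∪ D.marked Letter.e n}

/-- Each block of length `l_n q_n` has `q_n` labelled positions: `q_n - d_i` letters `b` and `d_i`
letters `e`. -/
theorem measure_labelled_succ_le (n : ℕ) : μ (D.labelled (n + 1)) ≤ (D.l n : ENNReal)⁻¹ := by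
  -- The last coordinate of the triple numbers the labelled positions of a block: below `q_n - d_i`
  -- the letters `b`, from there on the letters `e`, shifted past the `(l_n - 1) q_n` unlabelled
  -- positions.
  let f : Fin (D.q n) × Fin (D.k n) × Fin (D.q n) → ℤ := fun z =>
    ((z.1 * (D.k n * (D.l n * D.q n)) + (z.2.1 * (D.l n * D.q n) +
      (if (z.2.2 : ℕ) < D.q n - jnum (D.p n) (D.q n) z.1 then (z.2.2 : ℕ) else
        z.2.2 + (D.l n - 1) * D.q n)) : ℕ) : ℤ) * D.p (n + 1) % D.q (n + 1)
  have hsub : D.labelled (n + 1) ⊆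
      {x | ∃ z ∈ Finset.univ, cell (D.q (n + 1)) ((D.Zn (n + 1)).symm x).1 = f z} := by
    intro x hx
    obtain ⟨c, hc, t, ht, hxt⟩ : ∃ c : Letter Unit, c ≠ Letter.a () ∧
        ∃ t : ℕ, (D.template n)[t]? = some c ∧
          cell (D.q (n + 1)) ((D.Zn (n + 1)).symm x).1 = (t : ℤ) * D.p (n + 1) % D.q (n + 1) := by
      rcases hx with ⟨t, ht, hxt⟩ | ⟨t, ht, hxt⟩ <;>
      · rw [mem_Ico_iff_cell (D.q_pos _)] at hxt
        refine ⟨_, ?_, t, ht, ?_⟩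
        · exact fun h => Letter.noConfusion rfl (heq_of_eq h)
        · rw [hxt]
          push_cast
          rfl
    have htq : t < D.q (n + 1) := by
      rw [← D.length_template]
      exact (List.getElem?_eq_some_iff.1 ht).1
    obtain ⟨i, hi, j, o, ho, rfl⟩ := D.exists_position htq
    rw [D.template_getElem? j hi ho] at ht
    have hd : jnum (D.p n) (D.q n) i ≤ D.q n := jnum_le _ (D.q_pos n) i
    rcases D.position_cases (i := i) ho with h | ⟨m, hm, v, hv, rfl⟩ | ⟨o', ho', rfl⟩
    · refine ⟨⟨⟨i, hi⟩, j, ⟨o, by omega⟩⟩, Finset.mem_univ _, ?_⟩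
      simp only [f, if_pos h, hxt]
    · rw [block_getElem?_mid List.length_replicate hm hv, List.getElem?_replicate_of_lt hv] at ht
      exact absurd (Option.some.inj ht).symm hc
    · refine ⟨⟨⟨i, hi⟩, j, ⟨D.q n - jnum (D.p n) (D.q n) i + o', by omega⟩⟩,
        Finset.mem_univ _, ?_⟩
      simp only [f, if_neg (Nat.not_lt.2 (Nat.le_add_right _ o')), hxt]
      rw [show D.q n - jnum (D.p n) (D.q n) i + ((D.l n - 1) * D.q n + o') =
        D.q n - jnum (D.p n) (D.q n) i + o' + (D.l n - 1) * D.q n by ring]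
  refine (measure_mono hsub).trans ((D.measure_cell_mem_le (n + 1) _ _).trans ?_)
  refine natCast_mul_inv_le (D.l_pos n) (D.q_pos _) (le_of_eq ?_)
  rw [q_succ, Finset.card_univ, Fintype.card_prod, Fintype.card_prod, Fintype.card_fin,
    Fintype.card_fin]
  ring

/-- The tail `∑_{n ≥ m} 1 / l_n`. -/
noncomputable def tail (m : ℕ) : ENNReal := ∑' n, (D.l (n + m) : ENNReal)⁻¹

theorem tendsto_tail (hl : Summable fun n => 1 / (D.l n : ℝ)) :
    Tendsto D.tail atTop (𝓝 0) := by
  refine ENNReal.tendsto_sum_nat_add (fun n => (D.l n : ENNReal)⁻¹) ?_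
  have : ∀ n, (D.l n : ENNReal)⁻¹ = ENNReal.ofReal (1 / (D.l n : ℝ)) := fun n => by
    have : (0 : ℝ) < D.l n := by exact_mod_cast D.l_pos n
    rw [one_div, ENNReal.ofReal_inv_of_pos this, ENNReal.ofReal_natCast]
  simp only [this]
  exact hl.tsum_ofReal_ne_top

theorem measure_compl_Gam_le (m : ℕ) : μ (D.Gam m)ᶜ ≤ D.tail m := by
  have : (D.Gam m)ᶜ ⊆ ⋃ n, D.labelled (n + m + 1) := by
    intro x hx
    simp only [Gam, mem_compl_iff, mem_ofPred_eq, not_forall, not_not] at hx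
    obtain ⟨n, hn, hx⟩ := hx
    obtain ⟨c, rfl⟩ := Nat.exists_eq_add_of_lt hn
    rw [add_comm m c] at hx
    exact mem_iUnion.2 ⟨c, hx⟩
  exact (measure_mono this).trans ((measure_iUnion_le _).trans
    (ENNReal.tsum_le_tsum fun n => D.measure_labelled_succ_le _))

/-! ### Convergence of the periodic processes -/

/-- The inverse of `T_n`. -/
noncomputable def TnInv (n : ℕ) (y : X) : X :=
  D.Zn n (rot (-((D.p n : ℝ) / D.q n)) ((D.Zn n).symm y))

theorem TnInv_Tn (n : ℕ) (x : X) : D.TnInv n (D.Tn n x) = x := by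
  simp [TnInv, Tn, rot_neg_rot]

theorem Tn_TnInv (n : ℕ) (x : X) : D.Tn n (D.TnInv n x) = x := by
  simp [TnInv, Tn, rot_rot_neg]

theorem mem_Tn_image (n : ℕ) (A : Set X) (y : X) : y ∈ D.Tn n '' A ↔ D.TnInv n y ∈ A :=
  ⟨fun ⟨x, hx, h⟩ => by rwa [← h, TnInv_Tn], fun h => ⟨_, h, D.Tn_TnInv n y⟩⟩

/-- Two points lie in the same atom of `ζ_n`. -/
def SameAtom (n : ℕ) (x x' : X) : Prop :=
  cell (D.q n) ((D.Zn n).symm x).1 = cell (D.q n) ((D.Zn n).symm x').1 ∧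
    cell (D.s n) ((D.Zn n).symm x).2 = cell (D.s n) ((D.Zn n).symm x').2

theorem SameAtom.mem_iff {n : ℕ} {x x' : X} (h : D.SameAtom n x x') {A : Set X}
    (hA : A ∈ D.zeta n) : x ∈ A ↔ x' ∈ A := by
  obtain ⟨_, ⟨i, _, j, _, rfl⟩, rfl⟩ := hA
  rw [MeasurableEquiv.image_eq_preimage_symm, mem_preimage, mem_preimage,
    mem_rect_iff (D.q_pos n) (D.s_pos n), mem_rect_iff (D.q_pos n) (D.s_pos n), h.1, h.2]

theorem SameAtom.trans {n : ℕ} {x y z : X} (h : D.SameAtom n x y) (h' : D.SameAtom n y z) :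
    D.SameAtom n x z := ⟨h.1.trans h'.1, h.2.trans h'.2⟩

/-- Each `Z_n`-atom is a union of images of atoms of the `k_n q_n` by `s_{n+1}` grid. -/
theorem sameCell_h (n : ℕ) {y y' : Ann}
    (h1 : cell (D.k n * D.q n) y.1 = cell (D.k n * D.q n) y'.1)
    (h2 : cell (D.s (n + 1)) y.2 = cell (D.s (n + 1)) y'.2) :
    cell (D.q n) (D.h (n + 1) y).1 = cell (D.q n) (D.h (n + 1) y').1 ∧
      cell (D.s n) (D.h (n + 1) y).2 = cell (D.s n) (D.h (n + 1) y').2 := by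
  have hkq : 0 < D.k n * D.q n := Nat.mul_pos (D.k_pos n) (D.q_pos n)
  obtain ⟨i, hi, hi'⟩ := exists_cell hkq y.1
  obtain ⟨j, hj, hj'⟩ := exists_cell (D.s_pos (n + 1)) y.2
  obtain ⟨a, -, b, -, hab⟩ := D.h_perm n _ ⟨i, hi, j, hj, rfl⟩
  obtain ⟨c, hc⟩ := D.s_dvd_s n
  have hc0 : 0 < c := Nat.pos_of_ne_zero fun h0 => by
    have := D.s_pos (n + 1)
    simp [hc, h0] at this
  have m1 : D.h (n + 1) y ∈ rect (D.k n * D.q n) (D.s (n + 1)) a b :=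
    hab ▸ mem_image_of_mem _ ((mem_rect_iff hkq (D.s_pos _)).2 ⟨hi', hj'⟩)
  have m2 : D.h (n + 1) y' ∈ rect (D.k n * D.q n) (D.s (n + 1)) a b :=
    hab ▸ mem_image_of_mem _ ((mem_rect_iff hkq (D.s_pos _)).2 ⟨h1 ▸ hi', h2 ▸ hj'⟩)
  rw [mem_rect_iff hkq (D.s_pos _), mul_comm (D.k n), hc] at m1 m2
  rw [cell_eq_div (D.k_pos n), m1.1, cell_eq_div (D.k_pos n), m2.1, cell_eq_div hc0, m1.2,
    cell_eq_div (N := D.s n) hc0 (D.h (n + 1) y').2, m2.2]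
  exact ⟨rfl, rfl⟩

theorem cell_succ (n : ℕ) (x : ℝ) :
    cell (D.k n * D.q n) x = cell (D.q (n + 1)) x / (D.l n * D.q n : ℕ) := by
  rw [cell_eq_div (Nat.mul_pos (D.l_pos n) (D.q_pos n)), ← q_succ]

theorem SameAtom.of_succ {n : ℕ} {x x' : X} (h : D.SameAtom (n + 1) x x') :
    D.SameAtom n x x' := by
  rw [SameAtom, D.Zn_symm_eq n x, D.Zn_symm_eq n x']
  refine D.sameCell_h n ?_ h.2
  rw [cell_succ, cell_succ, h.1]

theorem SameAtom.of_le {m n : ℕ} (hmn : m ≤ n) {x x' : X} (h : D.SameAtom n x x') :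
    D.SameAtom m x x' := by
  induction n, hmn using Nat.le_induction with
  | base => exact h
  | succ n _ ih => exact ih (h.of_succ D)

/-- The points at which `τ_n` and `τ_{n+1}` may move the atoms of `ζ_n` differently. -/
def driftSet (n : ℕ) : Set X :=
  {y | ∃ i ∈ Finset.range (D.k n * D.q n),
    cell (D.q (n + 1)) ((D.Zn (n + 1)).symm y).1 = (i : ℤ) * (D.l n * D.q n)}

theorem measure_driftSet_le (n : ℕ) : μ (D.driftSet n) ≤ (D.l n : ENNReal)⁻¹ := by
  refine (D.measure_cell_mem_le (n + 1) _ _).trans ?_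
  refine natCast_mul_inv_le (D.l_pos n) (D.q_pos _) ?_
  rw [Finset.card_range, q_succ]
  exact Nat.mul_le_mul_left _ (Nat.le_mul_of_pos_right _ (D.q_pos n))

/-- As `α_{n+1} = α_n + 1/q_{n+1}`, the two inverse rotations differ by one column of width
`1/q_{n+1}`. This crosses a boundary of the `k_n q_n` grid only from the first column of a cell, and
`R_{α_n}` preserves such columns. -/
theorem sameAtom_TnInv {n : ℕ} {y : X} (hy : y ∉ D.driftSet n) :
    D.SameAtom n (D.TnInv n y) (D.TnInv (n + 1) y) := by
  have hlq : 0 < D.l n * D.q n := Nat.mul_pos (D.l_pos n) (D.q_pos n)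
  have hqR : (D.q n : ℝ) ≠ 0 := by exact_mod_cast (D.q_pos n).ne'
  have hkR : (D.k n : ℝ) ≠ 0 := by exact_mod_cast (D.k_pos n).ne'
  have hlR : (D.l n : ℝ) ≠ 0 := by exact_mod_cast (D.l_pos n).ne'
  set z := (D.Zn (n + 1)).symm y with hz
  set α := (D.p n : ℝ) / D.q n with hα
  have e1 : (D.Zn n).symm (D.TnInv n y) = D.h (n + 1) (rot (-α) z) := by
    rw [TnInv, MeasurableEquiv.symm_apply_apply, Zn_symm_eq, ← hz, ← hα]
    -- Commutation of `h_{n+1}` with `R_α` yields commutation with its inverse.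
    conv_lhs => rw [← rot_rot_neg α z]
    rw [hα, h_comm, rot_neg_rot]
  have e2 : (D.Zn n).symm (D.TnInv (n + 1) y) =
      D.h (n + 1) (rot (-((D.p (n + 1) : ℝ) / D.q (n + 1))) z) := by
    rw [TnInv, Zn_symm_eq, MeasurableEquiv.symm_apply_apply]
  have r1 : -α = ((-(D.p n * (D.k n * (D.l n * D.q n))) : ℤ) : ℝ) / D.q (n + 1) := by
    rw [hα, q_succ]
    push_cast
    field_simp
  have r2 : -((D.p (n + 1) : ℝ) / D.q (n + 1)) =
      ((-(D.p n * (D.k n * (D.l n * D.q n))) - 1 : ℤ) : ℝ) / D.q (n + 1) := by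
    rw [p_succ]
    push_cast
    ring
  rw [SameAtom, e1, e2]
  refine D.sameCell_h n ?_ rfl
  rw [cell_succ, cell_succ, r1, r2, cell_rot (D.q_pos _),
    cell_rot (D.q_pos _)]
  have hz' : ¬ ((D.l n * D.q n : ℕ) : ℤ) ∣ cell (D.q (n + 1)) z.1 := by
    rintro ⟨i, hi⟩
    have h0 := cell_nonneg (D.q (n + 1)) z.1
    have h1 := cell_lt (D.q_pos (n + 1)) z.1
    have hlqZ : (0 : ℤ) < (D.l n * D.q n : ℕ) := by exact_mod_cast hlq
    rw [hi] at h0 h1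
    have hi0 : 0 ≤ i := nonneg_of_mul_nonneg_right h0 hlqZ
    rw [q_succ, mul_comm] at h1
    push_cast at h1 hlqZ
    have hi1 : i < D.k n * D.q n := lt_of_mul_lt_mul_right h1 hlqZ.le
    refine hy ⟨i.toNat, ?_, ?_⟩
    · rw [Finset.mem_range]
      zify
      rwa [Int.toNat_of_nonneg hi0]
    · rw [← hz, hi, Int.toNat_of_nonneg hi0]
      push_cast
      ring
  set a := cell (D.q (n + 1)) z.1
  set L := D.l n * D.q n
  set c : ℤ := -(D.p n * (D.k n * (D.l n * D.q n)))
  have hLZ : (0 : ℤ) < L := by exact_mod_cast hlq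
  have hLq : (L : ℤ) ∣ D.q (n + 1) := by
    rw [q_succ]
    exact_mod_cast Dvd.intro_left _ rfl
  have hLc : (L : ℤ) ∣ c := by
    refine (Dvd.intro_left (-(D.p n * D.k n : ℤ)) ?_)
    simp only [L, c]
    push_cast
    ring
  -- Both `q_{n+1}` and `c` are multiples of `L`, so being a first column is unaffected by the
  -- rotation and the reduction.
  have hndvd : ¬ (L : ℤ) ∣ (a + c) % D.q (n + 1) := by
    rwa [Int.emod_def, dvd_sub_left (hLq.mul_right _), dvd_add_left hLc]
  set u := (a + c) % D.q (n + 1) with hu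
  have hu0 : 0 ≤ u := Int.emod_nonneg _ (by have := D.q_pos (n + 1); omega)
  have hu1 : u < D.q (n + 1) := Int.emod_lt_of_pos _ (by have := D.q_pos (n + 1); omega)
  have hu2 : u ≠ 0 := fun h => hndvd (h ▸ dvd_zero _)
  have : (a + (c - 1)) % D.q (n + 1) = u - 1 := by
    rw [← add_sub_assoc, ← Int.emod_sub_emod, ← hu]
    exact Int.emod_eq_of_lt (by omega) (by omega)
  rw [this]
  have hm0 := Int.emod_nonneg u hLZ.ne'
  have hm1 : u % L ≠ 0 := fun h => hndvd (Int.dvd_of_emod_eq_zero h)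
  have hm2 := Int.emod_lt_of_pos u hLZ
  have hdm := Int.mul_ediv_add_emod u L
  have hdiv : (u % L - 1) / L = 0 := Int.ediv_eq_zero_of_lt (by omega) (by linarith)
  rw [show u - 1 = u % L - 1 + L * (u / L) by linarith, Int.add_mul_ediv_left _ _ hLZ.ne', hdiv,
    zero_add]
end Construction

theorem measurePreserving_zpow {X : Type*} [MeasurableSpace X] {μ : Measure X} (T : X ≃ᵐ X)
    (hT : MeasurePreserving T μ μ) (n : ℤ) :
    MeasurePreserving ((T.toEquiv : Equiv.Perm X) ^ n) μ μ := by
  cases n with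
  | ofNat n =>
    rw [Int.ofNat_eq_natCast, zpow_natCast, ← Equiv.Perm.iterate_eq_pow]
    exact hT.iterate n
  | negSucc n =>
    rw [zpow_negSucc, ← inv_pow, ← Equiv.Perm.iterate_eq_pow]
    exact (hT.symm T).iterate (n + 1)

theorem zpow_natCast_add_apply {X : Type*} (T : Equiv.Perm X) (c : ℤ) (i : ℕ) (x : X) :
    (T ^ (c + i)) x = T^[i] ((T ^ c) x) := by
  rw [add_comm, zpow_add, Equiv.Perm.mul_apply, zpow_natCast, Equiv.Perm.iterate_eq_pow]

namespace Construction

variable {X : Type u} [MeasurableSpace X] {μ : Measure X} (D : Construction X μ)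

theorem sameAtom_TnInv_of_le {m n : ℕ} (hmn : m ≤ n) {y : X}
    (hy : ∀ k, y ∉ D.driftSet (k + m)) : D.SameAtom m (D.TnInv m y) (D.TnInv n y) := by
  induction n, hmn using Nat.le_induction with
  | base => exact ⟨rfl, rfl⟩
  | succ n hmn ih =>
    refine ih.trans D (SameAtom.of_le D hmn (D.sameAtom_TnInv ?_))
    have := hy (n - m)
    rwa [Nat.sub_add_cancel hmn] at this

/-- The points at which `T_n` and `T` move the atoms of `ζ_n` differently. -/
def errorSet (T : X ≃ᵐ X) (n : ℕ) : Set X :=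
  ⋃ A ∈ D.zeta n, symmDiff (D.Tn n '' A) (T '' A)

/-- Replacing `τ_m` by a later `τ_n` costs at most the sum of the drifts, which `tail m` bounds for
every `n`; then let `n → ∞` and use the limit hypothesis. -/
theorem measure_errorSet_le {T : X ≃ᵐ X} (hlim : D.IsLimit T) (m : ℕ) :
    μ (D.errorSet T m) ≤ D.tail m := by
  have h : ∀ n ≥ m, μ (D.errorSet T m) ≤ D.tail m +
      μ (⋃ A ∈ D.zeta m, symmDiff (D.Tn n '' A) (T '' A)) := by
    intro n hn
    have hsub : D.errorSet T m ⊆ (⋃ k, D.driftSet (k + m)) ∪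
        ⋃ A ∈ D.zeta m, symmDiff (D.Tn n '' A) (T '' A) := by
      intro y hy
      by_cases hd : ∃ k, y ∈ D.driftSet (k + m)
      · exact Or.inl (mem_iUnion.2 hd)
      push Not at hd
      right
      obtain ⟨A, hA, hyA⟩ := mem_iUnion₂.1 hy
      refine mem_iUnion₂.2 ⟨A, hA, ?_⟩
      -- Membership in `T_n A` depends only on the atom of `ζ_m` that holds the inverse image under
      -- `T_n`.
      rw [mem_symmDiff, mem_Tn_image] at hyA ⊢
      rwa [← (D.sameAtom_TnInv_of_le hn hd).mem_iff D hA]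
    refine (measure_mono hsub).trans ((measure_union_le _ _).trans ?_)
    gcongr
    exact (measure_iUnion_le _).trans (ENNReal.tsum_le_tsum fun k => D.measure_driftSet_le _)
  have ht : Tendsto (fun n => D.tail m +
      μ (⋃ A ∈ D.zeta m, symmDiff (D.Tn n '' A) (T '' A))) atTop (𝓝 (D.tail m + 0)) :=
    tendsto_const_nhds.add (hlim m)
  rw [add_zero] at ht
  exact ge_of_tendsto ht (eventually_atTop.2 ⟨m, h⟩)

/-! ### Climbing the towers along `T` and reading names -/

theorem OnLevel.Tn {n r t : ℕ} {x : X} (hx : D.OnLevel n r t x) :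
    D.OnLevel n r (t + 1) (D.Tn n x) := by
  refine ⟨?_, ?_⟩
  · rw [Construction.Tn, MeasurableEquiv.symm_apply_apply, ← Int.cast_natCast (D.p n),
      cell_rot (D.q_pos n), hx.1, Int.emod_add_emod]
    push_cast
    ring_nf
  · rw [Construction.Tn, MeasurableEquiv.symm_apply_apply]
    exact hx.2

theorem onLevel_of_sameAtom {n r t : ℕ} {x x' : X} (h : D.SameAtom n x x')
    (hx : D.OnLevel n r t x) : D.OnLevel n r t x' :=
  ⟨h.1 ▸ hx.1, h.2 ▸ hx.2⟩

theorem sameAtom_of_mem_iff {n : ℕ} {x x' : X} (h : ∀ A ∈ D.zeta n, x ∈ A → x' ∈ A) :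
    D.SameAtom n x x' := by
  obtain ⟨i, hi, hi'⟩ := exists_cell (D.q_pos n) ((D.Zn n).symm x).1
  obtain ⟨j, hj, hj'⟩ := exists_cell (D.s_pos n) ((D.Zn n).symm x).2
  have := h _ ⟨_, ⟨i, hi, j, hj, rfl⟩, rfl⟩
  rw [MeasurableEquiv.image_eq_preimage_symm, mem_preimage, mem_preimage,
    mem_rect_iff (D.q_pos n) (D.s_pos n), mem_rect_iff (D.q_pos n) (D.s_pos n)] at this
  have := this ⟨hi', hj'⟩
  exact ⟨hi'.trans this.1.symm, hj'.trans this.2.symm⟩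

/-- Off the error set, `x` and `T_n⁻¹(T x)` share an atom of `ζ_n`, so `T x` lies on the level to
which `T_n` would move `x`. -/
theorem OnLevel.apply {T : X ≃ᵐ X} {n r t : ℕ} {x : X} (hx : D.OnLevel n r t x)
    (hT : T x ∉ D.errorSet T n) : D.OnLevel n r (t + 1) (T x) := by
  have h : D.SameAtom n x (D.TnInv n (T x)) := by
    refine D.sameAtom_of_mem_iff fun A hA hxA => ?_
    by_contra hn
    refine hT (mem_iUnion₂.2 ⟨A, hA, Or.inr ⟨mem_image_of_mem _ hxA, ?_⟩⟩)
    rwa [mem_Tn_image]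
  have := (D.onLevel_of_sameAtom h hx).Tn D
  rwa [Tn_TnInv] at this

/-- The points that lie less than `M` levels below the top of the `n`-th towers. -/
def nearTop (M n : ℕ) : Set X :=
  {x | ∃ i ∈ Finset.range M, cell (D.q n) ((D.Zn n).symm x).1 =
    ((D.q n - (i + 1) : ℕ) : ℤ) * D.p n % D.q n}

theorem measure_nearTop_succ_le (M n : ℕ) :
    μ (D.nearTop M (n + 1)) ≤ M * (D.l n : ENNReal)⁻¹ := by
  refine (D.measure_cell_mem_le (n + 1) _ _).trans ?_
  rw [Finset.card_range]
  gcongr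
  rw [q_succ, mul_left_comm]
  exact Nat.le_mul_of_pos_right _ (Nat.mul_pos (Nat.mul_pos (D.k_pos n) (D.q_pos n)) (D.q_pos n))

/-- The points whose name along the first `M` iterates is not visible inside the `n`-th towers. -/
def badSet (T : X ≃ᵐ X) (M n : ℕ) : Set X :=
  D.nearTop M n ∪ ⋃ i ∈ Finset.range M, T^[i] ⁻¹' (D.errorSet T n ∪ (D.Gam n)ᶜ)

theorem measure_badSet_succ_le {T : X ≃ᵐ X} (hT : MeasurePreserving T μ μ) (hlim : D.IsLimit T)
    (M n : ℕ) : μ (D.badSet T M (n + 1)) ≤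
      M * (D.l n : ENNReal)⁻¹ + M * (D.tail (n + 1) + D.tail (n + 1)) := by
  refine (measure_union_le _ _).trans (add_le_add (D.measure_nearTop_succ_le M n) ?_)
  refine (measure_biUnion_finset_le _ _).trans ?_
  refine (Finset.sum_le_card_nsmul _ _ (D.tail (n + 1) + D.tail (n + 1)) fun i _ => ?_).trans ?_
  · rw [(hT.iterate i).measure_preimage_emb (measurableEmbedding_iterate T i)]
    exact (measure_union_le _ _).trans
      (add_le_add (D.measure_errorSet_le hlim _) (D.measure_compl_Gam_le _))
  · rw [Finset.card_range, nsmul_eq_mul]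

theorem tendsto_measure_badSet (hl : Summable fun n => 1 / (D.l n : ℝ)) {T : X ≃ᵐ X}
    (hT : MeasurePreserving T μ μ) (hlim : D.IsLimit T) (M : ℕ) :
    Tendsto (fun n => μ (D.badSet T M (n + 1))) atTop (𝓝 0) := by
  have ht := D.tendsto_tail hl
  have ht' : Tendsto (fun n => D.tail (n + 1)) atTop (𝓝 0) := ht.comp (tendsto_add_atTop_nat 1)
  -- The first term of a tail is at most the tail.
  have hl' : Tendsto (fun n => (D.l n : ENNReal)⁻¹) atTop (𝓝 0) :=
    tendsto_of_tendsto_of_tendsto_of_le_of_le tendsto_const_nhds ht (fun _ => zero_le) fun n => by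
      have := ENNReal.le_tsum (f := fun k => (D.l (k + n) : ENNReal)⁻¹) 0
      rwa [zero_add] at this
  have hM : (M : ENNReal) ≠ ⊤ := ENNReal.natCast_ne_top M
  have := (ENNReal.Tendsto.const_mul hl' (Or.inr hM)).add
    (ENNReal.Tendsto.const_mul (ht'.add ht') (Or.inr hM))
  simp only [add_zero, mul_zero] at this
  exact tendsto_of_tendsto_of_tendsto_of_le_of_le tendsto_const_nhds this (fun _ => zero_le)
    fun n => D.measure_badSet_succ_le hT hlim M n

theorem exists_infix_of_notMem_badSet {T : X ≃ᵐ X} {M n : ℕ} {x : X}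
    (hx : x ∉ D.badSet T M n) :
    ∃ w ∈ D.W n, (List.ofFn fun i : Fin M => D.letter (T^[i] x)) <:+: w := by
  obtain ⟨r, hr, t, ht, hxt⟩ := D.exists_onLevel n x
  have hgood : ∀ i < M, T^[i] x ∉ D.errorSet T n ∧ T^[i] x ∈ D.Gam n := by
    intro i hi
    by_contra h
    refine hx (Or.inr (mem_iUnion₂.2 ⟨i, Finset.mem_range.2 hi, ?_⟩))
    by_contra h'
    refine h ⟨fun h1 => h' (Or.inl h1), ?_⟩
    by_contra h2
    exact h' (Or.inr h2)
  have htop : t + M ≤ D.q n := by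
    by_contra h
    -- The number of levels above level `t`, which is below `M` when the orbit piece leaves the
    -- tower.
    refine hx (Or.inl ⟨D.q n - t - 1, Finset.mem_range.2 (by omega), ?_⟩)
    rw [hxt.1, show D.q n - (D.q n - t - 1 + 1) = t by omega]
  have hlevel : ∀ i < M, D.OnLevel n r (t + i) (T^[i] x) := by
    intro i
    induction i with
    | zero => exact fun _ => hxt
    | succ i ih =>
      intro hi
      have h := hgood (i + 1) hi
      rw [Function.iterate_succ_apply'] at h ⊢
      exact (ih (by omega)).apply D h.1
  refine ⟨D.word n ⟨r, hr⟩, ⟨_, rfl⟩, ?_⟩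
  have : (List.ofFn fun i : Fin M => D.letter (T^[i] x)) =
      ((D.word n ⟨r, hr⟩).drop t).take M := by
    refine List.ext_getElem? fun i => ?_
    rw [List.getElem?_take, List.getElem?_ofFn]
    split_ifs with hi
    · rw [List.getElem?_drop]
      exact (D.word_getElem? (by omega) (hgood i hi).2 (hlevel i hi)).symm
    · rfl
  rw [this]
  exact (List.take_prefix _ _).isInfix.trans (List.drop_suffix _ _).isInfix

/-- The points that are bad at every stage lie in sets of measure tending to `0`, so they form a
null set for each `M`. Invariance of `μ` handles the countably many starting times `c`. -/
theorem ae_name_mem_K (hl : Summable fun n => 1 / (D.l n : ℝ)) {T : X ≃ᵐ X}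
    (hT : MeasurePreserving T μ μ) (hlim : D.IsLimit T) : ∀ᵐ x ∂μ, D.name T x ∈ D.K := by
  have h : ∀ M : ℕ, ∀ᵐ x ∂μ, ∃ n, x ∉ D.badSet T M (n + 1) := by
    intro M
    rw [ae_iff]
    refine le_antisymm ?_ zero_le
    refine ge_of_tendsto' (D.tendsto_measure_badSet hl hT hlim M) fun n => measure_mono ?_
    intro x hx
    by_contra h
    exact hx ⟨n, h⟩
  have h' : ∀ᵐ x ∂μ, ∀ (c : ℤ) (M : ℕ), ∃ n,
      ((T.toEquiv : Equiv.Perm X) ^ c) x ∉ D.badSet T M (n + 1) :=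
    ae_all_iff.2 fun c => ae_all_iff.2 fun M =>
      (measurePreserving_zpow T hT c).quasiMeasurePreserving.ae (h M)
  filter_upwards [h'] with x hx c M
  obtain ⟨n, hn⟩ := hx c M
  refine ⟨n + 1, ?_⟩
  simp only [name, zpow_natCast_add_apply]
  exact D.exists_infix_of_notMem_badSet hn

/-! ### Measurability of names -/

theorem measurableSet_marked (c : Letter Unit) : ∀ n, MeasurableSet (D.marked c n)
  | 0 => MeasurableSet.empty
  | n + 1 => by
    have : D.marked c (n + 1) = ⋃ t : ℕ, {x : Ann | (D.template n)[t]? = some c ∧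
        cell (D.q (n + 1)) x.1 = (t * D.p (n + 1) % D.q (n + 1) : ℕ)} := by
      ext x
      simp only [marked, mem_iUnion, mem_ofPred_eq, mem_Ico_iff_cell (D.q_pos (n + 1))]
    rw [this]
    refine MeasurableSet.iUnion fun t => (MeasurableSet.const _).inter ?_
    exact ((measurable_cell _).comp (measurable_subtype_coe.comp measurable_fst))
      (measurableSet_singleton _)

theorem measurableSet_Gam (n : ℕ) : MeasurableSet (D.Gam n) := by
  have : D.Gam n = ⋂ m, ⋂ (_ : m > n), (D.labelled m)ᶜ := by
    ext x
    simp only [Gam, labelled, mem_iInter, mem_compl_iff, mem_ofPred_eq]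
  rw [this]
  exact MeasurableSet.iInter fun m => MeasurableSet.iInter fun _ =>
    ((D.Zn m).symm.measurable
      ((D.measurableSet_marked _ m).union (D.measurableSet_marked _ m))).compl

theorem measurableSet_lastLabel (c : Letter Unit) :
    MeasurableSet {x | ∃ n, x ∈ D.Gam n ∧ (D.Zn n).symm x ∈ D.marked c n} := by
  have : {x | ∃ n, x ∈ D.Gam n ∧ (D.Zn n).symm x ∈ D.marked c n} =
      ⋃ n, D.Gam n ∩ (D.Zn n).symm ⁻¹' D.marked c n := by
    ext x
    simp
  rw [this]
  exact MeasurableSet.iUnion fun n =>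
    (D.measurableSet_Gam n).inter ((D.Zn n).symm.measurable (D.measurableSet_marked c n))

theorem measurableSet_Q : ∀ c, MeasurableSet (D.Q c)
  | Letter.a i => by
    refine MeasurableSet.diff ?_
      ((D.measurableSet_lastLabel _).union (D.measurableSet_lastLabel _))
    rw [MeasurableEquiv.image_eq_preimage_symm]
    exact D.Z.symm.measurable
      ((measurable_subtype_coe.comp measurable_fst measurableSet_Ico).inter
        (measurable_subtype_coe.comp measurable_snd measurableSet_Ico))
  | Letter.b => D.measurableSet_lastLabel _
  | Letter.e => D.measurableSet_lastLabel _

theorem letter_eq_iff {x : X} {c : Letter (Fin (D.s 0))} : D.letter x = c ↔ x ∈ D.Q c :=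
  ⟨fun h => h ▸ (D.existsUnique_Q x).choose_spec.1, D.letter_eq⟩

end Construction

instance instCountableLetter (ι : Type) [Countable ι] : Countable (Letter ι) := by
  let f : Letter ι → Option (Option ι)
    | Letter.a i => some (some i)
    | Letter.b => some none
    | Letter.e => none
  refine Function.Injective.countable (f := f) ?_
  rintro (_ | _ | _) (_ | _ | _) h <;> simp_all [f]

instance instDiscreteMeasurableSpaceLetter (ι : Type) : DiscreteMeasurableSpace (Letter ι) :=
  ⟨fun _ => trivial⟩

namespace Construction

variable {X : Type u} [MeasurableSpace X] {μ : Measure X} (D : Construction X μ)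

theorem measurable_letter : Measurable D.letter :=
  measurable_to_countable' fun c => by
    have : D.letter ⁻¹' {c} = D.Q c := by
      ext x
      exact D.letter_eq_iff
    rw [this]
    exact D.measurableSet_Q c

theorem measurable_name {T : X ≃ᵐ X} (hT : MeasurePreserving T μ μ) : Measurable (D.name T) :=
  measurable_pi_lambda _ fun n => D.measurable_letter.comp (measurePreserving_zpow T hT n).measurable

theorem name_apply (T : X ≃ᵐ X) (x : X) (n : ℤ) : D.name T (T x) n = D.name T x (n + 1) := by
  rw [name, name, zpow_add_one]
  rfl

/-- The factor algebra consists of the preimages of measurable sets of names. -/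
theorem mem_factorAlgebra_iff (T : X ≃ᵐ X) {A : Set X} :
    A ∈ D.factorAlgebra T ↔ ∃ C, MeasurableSet C ∧ D.name T ⁻¹' C = A := by
  -- The sign changes because `x ∈ T^n C` means `T^{-n} x ∈ C`.
  have himage : ∀ (n : ℤ) c, ((T.toEquiv : Equiv.Perm X) ^ n) '' D.Q c =
      (fun x => D.name T x (-n)) ⁻¹' {c} := by
    intro n c
    ext x
    rw [mem_preimage, mem_singleton_iff, name, letter_eq_iff, zpow_neg]
    exact (Equiv.image_eq_preimage_symm _ _ ▸ Iff.rfl)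
  constructor
  · intro hA
    refine MeasurableSpace.generateFrom_le (m := MeasurableSpace.pi.comap (D.name T)) ?_ A hA
    rintro _ ⟨n, c, rfl⟩
    exact ⟨_, measurable_pi_apply (-n) (measurableSet_singleton c), (himage n c).symm⟩
  · rintro ⟨C, hC, rfl⟩
    refine (@measurable_pi_lambda X ℤ (fun _ => Letter (Fin (D.s 0))) (MeasurableSpace.generateFrom
      {C | ∃ (n : ℤ) (c : Letter (Fin (D.s 0))),
        C = ((T.toEquiv : Equiv.Perm X) ^ n) '' D.Q c}) _ (D.name T) fun n => ?_) hC
    refine @measurable_to_countable' _ _ _ _ (_) _ fun c => ?_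
    refine MeasurableSpace.measurableSet_generateFrom ⟨-n, c, ?_⟩
    rw [himage, neg_neg]

theorem measurableSet_K : MeasurableSet D.K := by
  have : D.K = ⋂ (c : ℤ) (m : ℕ), (fun (f : ℤ → Letter (Fin (D.s 0))) (i : Fin m) => f (c + i)) ⁻¹'
      {g | ∃ n, ∃ w ∈ D.W n, List.ofFn g <:+: w} := by
    ext f
    simp only [K, mem_iInter, mem_preimage, mem_ofPred_eq]
  rw [this]
  refine MeasurableSet.iInter fun c => MeasurableSet.iInter fun m => ?_
  exact (measurable_pi_lambda _ fun i => measurable_pi_apply _) (MeasurableSet.of_discrete)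

theorem measurable_shift : Measurable D.shift :=
  Measurable.subtype_mk (measurable_pi_lambda (fun (f : D.K) (n : ℤ) => f.1 (n + 1)) fun n =>
    (measurable_pi_apply (n + 1)).comp measurable_subtype_coe)

end Construction

/-! ### Factors determined by their algebras -/

section factors

variable {X : Type*} {Y : Type*} {Y' : Type*} [MeasurableSpace X] [MeasurableSpace Y]
  [MeasurableSpace Y'] {μ : Measure X}

/-- A map to a standard Borel space all of whose level sets are, modulo null sets, preimages under
`φ`, factors through `φ` almost everywhere. -/
theorem exists_measurable_comp_ae_eq [StandardBorelSpace Y'] [Nonempty Y'] (φ : X → Y)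
    (π : X → Y')
    (h : ∀ C : Set Y', MeasurableSet C → ∃ C' : Set Y, MeasurableSet C' ∧ π ⁻¹' C =ᵐ[μ] φ ⁻¹' C') :
    ∃ f : Y → Y', Measurable f ∧ f ∘ φ =ᵐ[μ] π := by
  classical
  -- Embed `Y'` in `{0,1}^ℕ`: each coordinate of `π` is almost everywhere the indicator of some `C
  -- n` along `φ`, and a measurable left inverse `e'` of the embedding reassembles the point.
  have he : MeasurableEmbedding (MeasurableSpace.mapNatBool Y') :=
    (MeasurableSpace.measurable_mapNatBool Y').measurableEmbedding
      (MeasurableSpace.injective_mapNatBool Y')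
  obtain ⟨e', he', hee'⟩ := he.exists_measurable_extend measurable_id fun _ => ‹Nonempty Y'›
  have hb : ∀ n, MeasurableSet {y | MeasurableSpace.mapNatBool Y' y n = true} := fun n =>
    (measurable_pi_apply n).comp (MeasurableSpace.measurable_mapNatBool Y')
      (measurableSet_singleton true)
  choose C hC hCe using fun n => h _ (hb n)
  refine ⟨fun y => e' fun n => decide (y ∈ C n), he'.comp (measurable_pi_lambda _ fun n =>
    measurable_to_bool ?_), ?_⟩
  · convert hC n
    ext y
    simp
  · filter_upwards [ae_all_iff.2 hCe] with x hx
    have : (fun n => decide (φ x ∈ C n)) = MeasurableSpace.mapNatBool Y' (π x) := by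
      funext n
      rw [Bool.eq_iff_iff, decide_eq_true_iff]
      exact (iff_of_eq (hx n)).symm
    change e' (fun n => decide (φ x ∈ C n)) = π x
    rw [this]
    exact congrFun hee' (π x)

/-- The common algebra lets each factor map be written through the other: `f ∘ φ = π` and `g ∘ π =
φ` almost everywhere. Identities between `f`, `g`, `S` and `S'` are then checked on `X`, where `φ`
and `π` push `μ` to `κ` and `κ'`. -/
theorem isomorphic_of_isFactorMapOnto {X : Type u} {Y : Type*} {Y' : Type*} [MeasurableSpace X]
    [MeasurableSpace Y] [StandardBorelSpace Y] [MeasurableSpace Y'] [StandardBorelSpace Y']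
    {μ : Measure X} [NeZero μ] {T : X → X} (hT : MeasurePreserving T μ μ) {F : Set (Set X)}
    {κ : Measure Y} {S : Y → Y} {κ' : Measure Y'} {S' : Y' → Y'} (hS : Measurable S)
    (hS' : Measurable S') {φ : X → Y} {π : X → Y'} (hφ : IsFactorMapOnto μ T F κ S φ)
    (hπ : IsFactorMapOnto μ T F κ' S' π) : Isomorphic κ S κ' S' := by
  have : Nonempty X := by
    by_contra h
    rw [not_nonempty_iff] at h
    exact NeZero.ne μ (Measure.eq_zero_of_isEmpty μ)
  have : Nonempty Y := this.map φ
  have : Nonempty Y' := this.map fun _ => π ‹Nonempty X›.some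
  obtain ⟨f, hf, hfe⟩ := exists_measurable_comp_ae_eq (μ := μ) φ π fun C hC => by
    obtain ⟨A, hA, hCA⟩ := hπ.preimage_mem C hC
    obtain ⟨C', hC', hAC⟩ := hφ.mem_preimage A hA
    exact ⟨C', hC', hCA.trans hAC⟩
  obtain ⟨g, hg, hge⟩ := exists_measurable_comp_ae_eq (μ := μ) π φ fun C hC => by
    obtain ⟨A, hA, hCA⟩ := hφ.preimage_mem C hC
    obtain ⟨C', hC', hAC⟩ := hπ.mem_preimage A hA
    exact ⟨C', hC', hCA.trans hAC⟩
  have hmφ := hφ.measurePreserving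
  have hmπ := hπ.measurePreserving
  refine ⟨f, g, ⟨hf, ?_⟩, ⟨hg, ?_⟩, ?_, ?_, ?_⟩
  · rw [← hmφ.map_eq, Measure.map_map hf hmφ.measurable, Measure.map_congr hfe, hmπ.map_eq]
  · rw [← hmπ.map_eq, Measure.map_map hg hmπ.measurable, Measure.map_congr hge, hmφ.map_eq]
  · rw [← hmφ.map_eq]
    refine (ae_map_iff hmφ.aemeasurable (measurableSet_eq_fun (hg.comp hf) measurable_id)).2 ?_
    filter_upwards [hfe, hge] with x h1 h2
    simp only [Function.comp_apply] at h1 h2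
    change g (f (φ x)) = φ x
    rw [h1, h2]
  · rw [← hmπ.map_eq]
    refine (ae_map_iff hmπ.aemeasurable (measurableSet_eq_fun (hf.comp hg) measurable_id)).2 ?_
    filter_upwards [hfe, hge] with x h1 h2
    simp only [Function.comp_apply] at h1 h2
    change f (g (π x)) = π x
    rw [h2, h1]
  · rw [← hmφ.map_eq]
    refine (ae_map_iff hmφ.aemeasurable (measurableSet_eq_fun (hf.comp hS) (hS'.comp hf))).2 ?_
    filter_upwards [hfe, hT.quasiMeasurePreserving.ae hfe, hφ.equivariant, hπ.equivariant]
      with x h1 h2 h3 h4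
    simp only [Function.comp_apply] at h1 h2 h3 h4 ⊢
    rw [← h3, h2, h4, h1]

end factors

end AK

/-! ### The main theorem -/

theorem mainTheorem8 {X : Type u} [MeasurableSpace X] (μ : Measure X)
    (D : AK.Construction X μ)
    (hreq1 : D.Requirement1) (hreq2 : D.Requirement2) (hreq3 : D.Requirement3)
    (hl : Summable fun n => 1 / (D.l n : ℝ))
    (T : X ≃ᵐ X) (hT : MeasurePreserving T μ μ) (hlim : D.IsLimit T) :
    (∀ᵐ x ∂μ, D.name T x ∈ D.K) ∧
    ∃ ν : Measure D.K, IsProbabilityMeasure ν ∧ MeasurePreserving D.shift ν ν ∧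
      (∃ φ : X → D.K, (∀ᵐ x ∂μ, (φ x : ℤ → AK.Letter (Fin (D.s 0))) = D.name T x) ∧
        AK.IsFactorMapOnto μ T (D.factorAlgebra T) ν D.shift φ) ∧
      ∀ (Y : Type v) [MeasurableSpace Y] [StandardBorelSpace Y] (κ : Measure Y) (S : Y → Y),
        MeasurePreserving S κ κ →
        (∃ π : X → Y, AK.IsFactorMapOnto μ T (D.factorAlgebra T) κ S π) →
        AK.Isomorphic ν D.shift κ S := by
  classical
  have hK := D.ae_name_mem_K hl hT hlim
  have hμ : IsProbabilityMeasure μ :=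
    D.Z_measurePreserving.map_eq ▸
      Measure.isProbabilityMeasure_map D.Z_measurePreserving.aemeasurable
  have hKm := D.measurableSet_K
  have hname := D.measurable_name hT
  have hstd : StandardBorelSpace D.K := hKm.standardBorel
  obtain ⟨x₀, hx₀⟩ := hK.exists
  -- The name map, redirected to a fixed point of `K` on the null set where the name leaves `K`.
  let φ : X → D.K := fun x => if h : D.name T x ∈ D.K then ⟨D.name T x, h⟩ else ⟨_, hx₀⟩
  have hφe : ∀ᵐ x ∂μ, (φ x : ℤ → AK.Letter (Fin (D.s 0))) = D.name T x := by
    filter_upwards [hK] with x hx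
    simp only [φ, dif_pos hx]
  have hφm : Measurable φ := by
    have : φ = fun x => ⟨if D.name T x ∈ D.K then D.name T x else D.name T x₀, by
        split_ifs with h <;> assumption⟩ := by
      funext x
      simp only [φ]
      split_ifs <;> rfl
    rw [this]
    exact (Measurable.ite (hname hKm) hname measurable_const).subtype_mk
  have hequi : φ ∘ T =ᵐ[μ] D.shift ∘ φ := by
    filter_upwards [hφe, hT.quasiMeasurePreserving.ae hφe] with x h1 h2
    refine Subtype.ext (funext fun n => ?_)
    change (φ (T x)).1 n = (φ x).1 (n + 1)
    rw [h1, h2, D.name_apply]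
  have hfac : AK.IsFactorMapOnto μ T (D.factorAlgebra T) (μ.map φ) D.shift φ := by
    refine ⟨⟨hφm, rfl⟩, hequi, ?_, ?_⟩
    · rintro _ ⟨C, hC, rfl⟩
      refine ⟨_, (D.mem_factorAlgebra_iff T).2 ⟨C, hC, rfl⟩, ?_⟩
      filter_upwards [hφe] with x hx
      exact congrArg C hx
    · intro A hA
      obtain ⟨C, hC, rfl⟩ := (D.mem_factorAlgebra_iff T).1 hA
      refine ⟨Subtype.val ⁻¹' C, measurable_subtype_coe hC, ?_⟩
      filter_upwards [hφe] with x hx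
      exact congrArg C hx.symm
  refine ⟨hK, μ.map φ, Measure.isProbabilityMeasure_map hφm.aemeasurable,
    ⟨D.measurable_shift, ?_⟩, ⟨φ, hφe, hfac⟩, ?_⟩
  -- Shift invariance of `ν` is invariance of `μ` under `T`, carried over by equivariance of `φ`.
  · rw [Measure.map_map D.measurable_shift hφm, ← Measure.map_congr hequi,
      ← Measure.map_map hφm hT.measurable, hT.map_eq]
  · rintro Y _ _ κ S hS ⟨π, hπ⟩
    exact AK.isomorphic_of_isFactorMapOnto hT D.measurable_shift hS.measurable hfac hπ
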